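/- Work in either the smooth ($C^\infty$) or the real-analytic category; all functions, submanifolds, maps and diffeomorphisms are of the chosen class, and all germs are germs at the origin. Let $M=\mathbb R^m$, let $T^*M=\{(\kappa,\lambda)\}$ carry the symplectic form $\omega=\sum_{i=1}^m d\kappa_i\wedge d\lambda_i$ and the projection $\pi(\kappa,\lambda)=\lambda$, and put $\zeta(\kappa,\lambda)=(-\kappa,\lambda)$. A germ at $0$ of a Lagrangian submanifold $L\subset T^*M$ (and the Lagrangian map-germ $\pi|_L$) is called fibred-$\mathbb Z_2$-symmetric if $\zeta(L)=L$ as germs. Two fibred-$\mathbb Z_2$-symmetric Lagrangian map-germs $\pi|_{L_1},\pi|_{L_2}$ are $\mathbb Z_2$-symmetrically Lagrangian equivalent if there is a symplectomorphism-germ $\Phi:(T^*M,0)\to(T^*M,0)$ that maps fibres of $\pi$ to fibres of $\pi$, is odd, i.e. $\Phi\circ\zeta=\zeta\circ\Phi$, and maps the germ $L_1$ to the germ $L_2$. A function-germ $F:(\mathbb R^n\times\mathbb R^m,0)\to\mathbb R$, $F=F(\beta,\lambda)$, is an odd generating family of $L$ if $F(-\beta,\lambda)\equiv-F(\beta,\lambda)$,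 if $\frac{\partial F}{\partial\beta}(0,0)=0$ and the graph of $dF$ in $T^*\mathbb R^{n+m}$ is transversal, over the origin, to the set of covectors that annihilate the vectors tangent to the fibres of $(\beta,\lambda)\mapsto\lambda$, and if, as a germ at $0$, $$L=\Big\{(\kappa,\lambda)\;\Big|\;\exists\,\beta:\ \frac{\partial F}{\partial\beta}(\beta,\lambda)=0,\ \kappa=\frac{\partial F}{\partial\lambda}(\beta,\lambda)\Big\},$$ where $(\beta,\lambda)$ ranges over any sufficiently small neighbourhood of the origin. Two odd generating families $F_1,F_2$, in $n_1$ and $n_2$ variables $\beta$ respectively, are fibred $\mathcal R^{odd}$-equivalent if $n_1=n_2=n$ and there is a diffeomorphism-germ $\Psi$ of $(\mathbb R^n\times\mathbb R^m,0)$ of the form $\Psi(\beta,\lambda)=(\Phi(\beta,\lambda),\Lambda(\lambda))$, with $\Phi(-\beta,\lambda)\equiv-\Phi(\beta,\lambda)$ and with $\Phi(\cdot,\lambda)$ a diffeomorphism-germ of $(\mathbb R^n,0)$ for every $\lambda$ near $0$, such that $F_1=F_2\circ\Psi$. Theorem. Let $\pi|_{L_1}$ and $\pi|_{L_2}$ be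 fibred-$\mathbb Z_2$-symmetric Lagrangian map-germs, and let $F_1$ and $F_2$ be any odd generating families of $L_1$ and $L_2$. Then $\pi|_{L_1}$ and $\pi|_{L_2}$ are $\mathbb Z_2$-symmetrically Lagrangian equivalent if and only if $F_1$ and $F_2$ are fibred $\mathcal R^{odd}$-equivalent. -/

import Mathlib

open Filter Topology
open scoped ContDiff

/-- The small phase space `T*ℝᵐ`, with coordinates `(κ, λ)`: momenta first, base point second.
All germs below are germs at the origin, and a germ of a function or of a set is given by a
representative, every notion depending only on its behaviour near the origin. -/
abbrev PhaseSpace (m : ℕ) : Type := (Fin m → ℝ) × (Fin m → ℝ)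

/-- The big space `ℝⁿ × ℝᵐ`, with coordinates `(β, λ)`. -/
abbrev BigSpace (n m : ℕ) : Type := (Fin n → ℝ) × (Fin m → ℝ)

/-- The big phase space `T*(ℝⁿ × ℝᵐ)`, with coordinates `((α, κ), (β, λ))`. -/
abbrev BigPhaseSpace (n m : ℕ) : Type := BigSpace n m × BigSpace n m

/-- `f` is of class `C^r` on some neighbourhood of the origin. -/
def IsSmoothGerm {E E' : Type*} [NormedAddCommGroup E] [NormedSpace ℝ E]
    [NormedAddCommGroup E'] [NormedSpace ℝ E'] (r : WithTop ℕ∞) (f : E → E') : Prop :=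
  ∃ U ∈ 𝓝 (0 : E), ContDiffOn ℝ r f U

/-- `f` represents a `C^r` diffeomorphism-germ `(E, 0) → (E', 0)`, that is, an invertible
`C^r` map-germ with `C^r` inverse. -/
def IsDiffeoGerm {E E' : Type*} [NormedAddCommGroup E] [NormedSpace ℝ E]
    [NormedAddCommGroup E'] [NormedSpace ℝ E'] (r : WithTop ℕ∞) (f : E → E') : Prop :=
  f 0 = 0 ∧ IsSmoothGerm r f ∧
    ∃ g : E' → E, g 0 = 0 ∧ IsSmoothGerm r g ∧
      (∀ᶠ x in 𝓝 (0 : E), g (f x) = x) ∧ (∀ᶠ y in 𝓝 (0 : E'), f (g y) = y)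

/-- The canonical symplectic form `∑ dκᵢ ∧ dλᵢ` of `T*ℝᵐ`. -/
def canonicalForm {m : ℕ} (v w : PhaseSpace m) : ℝ :=
  ∑ i, (v.1 i * w.2 i - w.1 i * v.2 i)

/-- The involution `ζ (κ, λ) = (-κ, λ)`. -/
def fibreInvolution {m : ℕ} (x : PhaseSpace m) : PhaseSpace m := (-x.1, x.2)

/-- The germ of `L` at the origin is the germ of an embedded `m`-dimensional `C^r` submanifold
through the origin on which the canonical symplectic form vanishes. -/
def IsLagrangianGerm {m : ℕ} (r : WithTop ℕ∞) (L : Set (PhaseSpace m)) : Prop :=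
  ∃ (U : Set (Fin m → ℝ)) (j : (Fin m → ℝ) → PhaseSpace m),
    IsOpen U ∧ 0 ∈ U ∧ j 0 = 0 ∧ ContDiffOn ℝ r j U ∧ Topology.IsEmbedding (fun u : U => j u) ∧
    (∀ u ∈ U, Function.Injective (fderiv ℝ j u)) ∧
    (∀ u ∈ U, ∀ v w, canonicalForm (fderiv ℝ j u v) (fderiv ℝ j u w) = 0) ∧
    ∀ᶠ x in 𝓝 (0 : PhaseSpace m), x ∈ L ↔ x ∈ j '' U

/-- The germ of `L` at the origin is fibred-`ℤ₂`-symmetric. -/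
def IsFibredSymmetricGerm {m : ℕ} (L : Set (PhaseSpace m)) : Prop :=
  ∀ᶠ x in 𝓝 (0 : PhaseSpace m), x ∈ L → fibreInvolution x ∈ L

/-- `Φ` represents an odd fibred symplectomorphism-germ of `(T*ℝᵐ, 0)`. -/
structure IsOddFibredSymplectoGerm {m : ℕ} (r : WithTop ℕ∞)
    (Φ : PhaseSpace m → PhaseSpace m) : Prop where
  diffeo : IsDiffeoGerm r Φ
  fibred : ∃ U ∈ 𝓝 (0 : PhaseSpace m), ∀ x ∈ U, ∀ y ∈ U, x.2 = y.2 → (Φ x).2 = (Φ y).2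
  symplectic : ∀ᶠ x in 𝓝 (0 : PhaseSpace m), ∀ v w,
    canonicalForm (fderiv ℝ Φ x v) (fderiv ℝ Φ x w) = canonicalForm v w
  odd : ∀ᶠ x in 𝓝 (0 : PhaseSpace m), Φ (fibreInvolution x) = fibreInvolution (Φ x)

/-- `ℤ₂`-symmetric Lagrangian equivalence of the Lagrangian map-germs `π|L₁` and `π|L₂`: an odd
fibred symplectomorphism-germ maps the germ of `L₁` to the germ of `L₂`. -/
def SymmetricallyLagrangianEquivalent {m : ℕ} (r : WithTop ℕ∞)
    (L₁ L₂ : Set (PhaseSpace m)) : Prop :=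
  ∃ Φ : PhaseSpace m → PhaseSpace m, IsOddFibredSymplectoGerm r Φ ∧
    ∀ᶠ x in 𝓝 (0 : PhaseSpace m), x ∈ L₁ ↔ Φ x ∈ L₂

/-- The partial gradient `∂F/∂β`. -/
noncomputable def gradVar {n m : ℕ} (F : BigSpace n m → ℝ) (p : BigSpace n m) : Fin n → ℝ :=
  fun i => fderiv ℝ F p (Pi.single i 1, 0)

/-- The partial gradient `∂F/∂λ`. -/
noncomputable def gradPar {n m : ℕ} (F : BigSpace n m → ℝ) (p : BigSpace n m) : Fin m → ℝ :=
  fun i => fderiv ℝ F p (0, Pi.single i 1)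

/-- The Lagrangian section `dF` of the big phase space with generating function `F`. -/
noncomputable def lagrangianSection {n m : ℕ} (F : BigSpace n m → ℝ) (p : BigSpace n m) :
    BigPhaseSpace n m :=
  ((gradVar F p, gradPar F p), p)

/-- The mixed space `{α = 0}` in the big phase space. -/
def mixedSpace (n m : ℕ) : Submodule ℝ (BigPhaseSpace n m) where
  carrier := {z | z.1.1 = 0}
  add_mem' := fun {a b} ha hb => by
    have ha' : a.1.1 = 0 := ha
    have hb' : b.1.1 = 0 := hb
    simp [ha', hb']
  zero_mem' := rfl
  smul_mem' := fun c a ha => by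
    have ha' : a.1.1 = 0 := ha
    simp [ha']

/-- The germ at the origin of the Lagrangian section generated by `F` meets the mixed space over
the origin and is transversal to it there (hence near the origin: transversality is an open
condition). -/
def IsRhoRegular {n m : ℕ} (F : BigSpace n m → ℝ) : Prop :=
  lagrangianSection F 0 ∈ mixedSpace n m ∧
    LinearMap.range (fderiv ℝ (lagrangianSection F) 0 : BigSpace n m →ₗ[ℝ] BigPhaseSpace n m) ⊔
      mixedSpace n m = ⊤

/-- The subset of the small phase space determined by the restriction of the family `F` to `U`:
`{(κ, λ) | ∃ β, (β, λ) ∈ U, ∂F/∂β (β, λ) = 0, κ = ∂F/∂λ (β, λ)}`. -/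
def generatedSet {n m : ℕ} (F : BigSpace n m → ℝ) (U : Set (BigSpace n m)) :
    Set (PhaseSpace m) :=
  {x | ∃ β : Fin n → ℝ, (β, x.2) ∈ U ∧ gradVar F (β, x.2) = 0 ∧ x.1 = gradPar F (β, x.2)}

/-- `F` represents an odd generating family-germ of the germ of `L` at the origin: it is odd in
the variables `β`, its Lagrangian section is `ρ`-regular, and the restriction of `F` to any
sufficiently small neighbourhood of the origin determines the germ of `L`. -/
structure IsOddGeneratingFamily {n m : ℕ} (r : WithTop ℕ∞) (F : BigSpace n m → ℝ)
    (L : Set (PhaseSpace m)) : Prop where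
  smooth : IsSmoothGerm r F
  odd : ∀ᶠ p in 𝓝 (0 : BigSpace n m), F (-p.1, p.2) = -F p
  regular : IsRhoRegular F
  generates : ∃ U₀ ∈ 𝓝 (0 : BigSpace n m), ∀ U ∈ 𝓝 (0 : BigSpace n m), U ⊆ U₀ →
    ∀ᶠ x in 𝓝 (0 : PhaseSpace m), x ∈ L ↔ x ∈ generatedSet F U

/-- Fibred `R^odd`-equivalence of family-germs: `F = G ∘ Ψ` for a diffeomorphism-germ
`Ψ (β, λ) = (Φ (β, λ), Λ λ)` such that `Φ (·, λ)` is an odd diffeomorphism-germ at `0` for every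
`λ`. The numbers of variables are two names `n`, `n'`; they coincide whenever such a `Ψ` exists. -/
def FibredRoddEquivalent {n n' m : ℕ} (r : WithTop ℕ∞)
    (F : BigSpace n m → ℝ) (G : BigSpace n' m → ℝ) : Prop :=
  ∃ (Φ : BigSpace n m → (Fin n' → ℝ)) (Λ : (Fin m → ℝ) → (Fin m → ℝ)),
    IsDiffeoGerm r (fun p : BigSpace n m => ((Φ p, Λ p.2) : BigSpace n' m)) ∧
    (∀ᶠ p in 𝓝 (0 : BigSpace n m), Φ (-p.1, p.2) = -Φ p) ∧
    (∀ᶠ l in 𝓝 (0 : Fin m → ℝ), IsDiffeoGerm r (fun β : Fin n → ℝ => Φ (β, l))) ∧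
    ∀ᶠ p in 𝓝 (0 : BigSpace n m), F p = G (Φ p, Λ p.2)

/-! If F₁ = F₂ ∘ (Φ, Λ), the chain rule carries critical points of F₁ to critical points of F₂ and
relates their momenta through the transpose of dΛ. Hence the cotangent lift of Λ carries L₁ to L₂.
The lift preserves the tautological form κ dλ, so it is symplectic, and it is linear on fibres, so
it is odd.

Conversely, let T be an odd fibred symplectomorphism over Λ carrying L₁ to L₂. Fibred
symplectomorphisms are cotangent lifts up to a translation in the fibres. Oddness preserves the zero
section and kills the translation, so T preserves κ dλ (`IsOddFibredSymplectoGerm.exists_base`).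
Then G(β, λ) = F₂(β, Λ λ) generates the same germ as F₁, and the theorem reduces to uniqueness of
odd generating families (`IsOddFamily.exists_change`).

For an odd F the gradient v = ∂F/∂β is even in β, so ∂²F/∂β² vanishes at the origin. Regularity then
forces the mixed block ∂²F/∂β∂λ to have rank n, and β ↦ ∂F/∂λ is an odd immersion. Thus n is
determined by the germ and no stabilisation is needed. A linear projection of ∂F/∂λ serves as fibre
variable for both families, and matching these variables makes G ∘ Φ agree with F to first order on
the critical set {v = 0}. Since v is a submersion, D = G ∘ Φ − F is a quadratic form A(v, v), by
Hadamard's lemma (`SmoothNear.exists_quadratic_division`).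

Finally F + A(v, v) = F(β + s v, λ) for a matrix s found by the implicit function theorem
(`IsOddFamily.exists_reparametrisation`). Oddness of A gives A(0) = 0, hence a small s, so no
homotopy argument is needed. Every step stays in the chosen class because the averages in Hadamard's
lemma do. -/

/-- `f` is of class `C^r` at all points near `a`. -/
def SmoothNear {E E' : Type*} [NormedAddCommGroup E] [NormedSpace ℝ E]
    [NormedAddCommGroup E'] [NormedSpace ℝ E'] (r : WithTop ℕ∞) (f : E → E') (a : E) : Prop :=
  ∀ᶠ x in 𝓝 a, ContDiffAt ℝ r f x

/-! ### Calculus of germs and the inverse function theorem. -/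

section Germs

variable {E E' E'' : Type*} [NormedAddCommGroup E] [NormedSpace ℝ E]
  [NormedAddCommGroup E'] [NormedSpace ℝ E'] [NormedAddCommGroup E''] [NormedSpace ℝ E'']
  {r : WithTop ℕ∞}

theorem isSmoothGerm_iff {f : E → E'} : IsSmoothGerm r f ↔ SmoothNear r f 0 := by
  constructor
  · rintro ⟨U, hU, hf⟩
    filter_upwards [eventually_mem_nhds_iff.2 hU] with x hx using hf.contDiffAt hx
  · intro h
    exact ⟨_, h, fun x hx => ContDiffAt.contDiffWithinAt hx⟩

theorem ne_zero_of_infty_or_omega (hr : r = ∞ ∨ r = ω) : r ≠ 0 := by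
  rcases hr with rfl | rfl <;> simp

theorem add_one_le_of_infty_or_omega (hr : r = ∞ ∨ r = ω) : r + 1 ≤ r := by
  rcases hr with rfl | rfl <;> simp

namespace SmoothNear

theorem contDiffAt {f : E → E'} {a : E} (h : SmoothNear r f a) : ContDiffAt ℝ r f a :=
  h.self_of_nhds

theorem of_contDiff {f : E → E'} {a : E} (h : ContDiff ℝ r f) : SmoothNear r f a :=
  Eventually.of_forall fun _ => h.contDiffAt

theorem continuousAt {f : E → E'} {a : E} (h : SmoothNear r f a) : ContinuousAt f a :=
  h.contDiffAt.continuousAt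

theorem tendsto {f : E → E'} {a : E} {b : E'} (h : SmoothNear r f a) (hb : f a = b) :
    Tendsto f (𝓝 a) (𝓝 b) := hb ▸ h.continuousAt

theorem differentiableAt {f : E → E'} {a : E} (h : SmoothNear r f a) (hr : r = ∞ ∨ r = ω) :
    DifferentiableAt ℝ f a :=
  h.contDiffAt.differentiableAt (ne_zero_of_infty_or_omega hr)

theorem eventually_differentiableAt {f : E → E'} {a : E} (h : SmoothNear r f a)
    (hr : r = ∞ ∨ r = ω) : ∀ᶠ x in 𝓝 a, DifferentiableAt ℝ f x := by
  filter_upwards [h] with x hx using hx.differentiableAt (ne_zero_of_infty_or_omega hr)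

theorem comp {g : E' → E''} {f : E → E'} {a : E} {b : E'} (hg : SmoothNear r g b)
    (hf : SmoothNear r f a) (hb : f a = b) : SmoothNear r (fun x => g (f x)) a := by
  filter_upwards [hf, (hf.tendsto hb).eventually hg] with x hx hgx using hgx.comp x hx

theorem continuousLinearMap_comp (L : E' →L[ℝ] E'') {f : E → E'} {a : E}
    (hf : SmoothNear r f a) : SmoothNear r (fun x => L (f x)) a := by
  filter_upwards [hf] with x hx using L.contDiff.contDiffAt.comp x hx

theorem prodMk {f : E → E'} {g : E → E''} {a : E} (hf : SmoothNear r f a)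
    (hg : SmoothNear r g a) : SmoothNear r (fun x => (f x, g x)) a := by
  filter_upwards [hf, hg] with x hx hgx using hx.prodMk hgx

theorem add {f g : E → E'} {a : E} (hf : SmoothNear r f a)
    (hg : SmoothNear r g a) : SmoothNear r (fun x => f x + g x) a := by
  filter_upwards [hf, hg] with x hx hgx using hx.add hgx

theorem sub {f g : E → E'} {a : E} (hf : SmoothNear r f a)
    (hg : SmoothNear r g a) : SmoothNear r (fun x => f x - g x) a := by
  filter_upwards [hf, hg] with x hx hgx using hx.sub hgx

theorem clm_apply {f : E → E' →L[ℝ] E''} {g : E → E'} {a : E} (hf : SmoothNear r f a)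
    (hg : SmoothNear r g a) : SmoothNear r (fun x => f x (g x)) a := by
  filter_upwards [hf, hg] with x hx hgx using hx.clm_apply hgx

theorem clm_comp {G : Type*} [NormedAddCommGroup G] [NormedSpace ℝ G]
    {f : E → E' →L[ℝ] E''} {g : E → G →L[ℝ] E'} {a : E} (hf : SmoothNear r f a)
    (hg : SmoothNear r g a) : SmoothNear r (fun x => (f x).comp (g x)) a := by
  filter_upwards [hf, hg] with x hx hgx using hx.clm_comp hgx

theorem fderiv_right (hr : r = ∞ ∨ r = ω) {f : E → E'} {a : E} (hf : SmoothNear r f a) :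
    SmoothNear r (fderiv ℝ f) a := by
  filter_upwards [hf] with x hx using hx.fderiv_right (add_one_le_of_infty_or_omega hr)

theorem pi {ι : Type*} [Fintype ι] {f : E → ι → E'} {a : E}
    (hf : ∀ i, SmoothNear r (fun x => f x i) a) : SmoothNear r f a := by
  filter_upwards [eventually_all.2 hf] with x hx using contDiffAt_pi.2 hx

end SmoothNear

/-- The inverse must be smooth at every point near 0: for `r = ∞`, `ContDiffAt` at one point only
gives neighbourhoods that may shrink with the order. Invertible operators form an open set, so the
derivative stays invertible near 0 and the inverse is smooth at each nearby image. -/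
theorem SmoothNear.exists_local_inverse [CompleteSpace E] (hr : r = ∞ ∨ r = ω) {f : E → E'}
    (hf : SmoothNear r f 0) (h0 : f 0 = 0) (f' : E ≃L[ℝ] E')
    (hf' : HasFDerivAt f (f' : E →L[ℝ] E') 0) :
    ∃ g : E' → E, g 0 = 0 ∧ SmoothNear r g 0 ∧
      (∀ᶠ x in 𝓝 (0 : E), g (f x) = x) ∧ (∀ᶠ y in 𝓝 (0 : E'), f (g y) = y) := by
  have hn := ne_zero_of_infty_or_omega hr
  let e := hf.contDiffAt.toOpenPartialHomeomorph f hf' hn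
  have he : (e : E → E') = f := rfl
  have hs : (0 : E) ∈ e.source := hf.contDiffAt.mem_toOpenPartialHomeomorph_source hf' hn
  have ht : (0 : E') ∈ e.target := by
    have := e.map_source hs
    rwa [he, h0] at this
  have hg0 : e.symm 0 = 0 := by
    have := e.left_inv hs
    rwa [he, h0] at this
  have hl : ∀ᶠ x in 𝓝 (0 : E), e.symm (f x) = x := by
    filter_upwards [e.open_source.mem_nhds hs] with x hx using e.left_inv hx
  have hri : ∀ᶠ y in 𝓝 (0 : E'), f (e.symm y) = y := by
    filter_upwards [e.open_target.mem_nhds ht] with x hx using e.right_inv hx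
  refine ⟨e.symm, hg0, ?_, hl, hri⟩
  have hc : Tendsto e.symm (𝓝 0) (𝓝 0) := by
    have := e.continuousAt_symm ht
    rwa [ContinuousAt, hg0] at this
  have hinv : ∀ᶠ x in 𝓝 (0 : E), ∃ A : E ≃L[ℝ] E', (A : E →L[ℝ] E') = fderiv ℝ f x := by
    have h1 : ContinuousAt (fderiv ℝ f) 0 := (hf.fderiv_right hr).continuousAt
    exact h1.eventually (p := fun B => ∃ A : E ≃L[ℝ] E', (A : E →L[ℝ] E') = B)
      (hf'.fderiv ▸ ContinuousLinearEquiv.nhds f')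
  filter_upwards [hc.eventually hinv, hc.eventually hf, e.open_target.mem_nhds ht]
    with y hy hfy hyt
  obtain ⟨A, hA⟩ := hy
  refine e.contDiffAt_symm (f₀' := A) hyt ?_ hfy
  rw [hA]
  exact (hfy.differentiableAt hn).hasFDerivAt

end Germs

/-! ### Regularity of the averages ∫₀¹ g(s x, y) ds. -/

section Averages

open MeasureTheory

variable {X Y Z : Type*} [NormedAddCommGroup X] [NormedSpace ℝ X]
  [NormedAddCommGroup Y] [NormedSpace ℝ Y] [NormedAddCommGroup Z] [NormedSpace ℝ Z]

/-- The maps (x, y) ↦ (s x, y) with 0 ≤ s ≤ 1 are contractions. Composing the power series of g with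
them and integrating over s does not increase the norms of the coefficients, so the integrated
series converges on the same ball. -/
theorem analyticAt_integral_scale [CompleteSpace Z] {g : X × Y → Z} (hg : AnalyticAt ℝ g 0) :
    AnalyticAt ℝ (fun p : X × Y => ∫ s in (0 : ℝ)..1, g (s • p.1, p.2)) 0 := by
  obtain ⟨p, R, hp⟩ := hg
  let T : ℝ → (X × Y →L[ℝ] X × Y) := fun s =>
    s • (ContinuousLinearMap.inl ℝ X Y).comp (ContinuousLinearMap.fst ℝ X Y) +
      (ContinuousLinearMap.inr ℝ X Y).comp (ContinuousLinearMap.snd ℝ X Y)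
  have hT : ∀ s w, T s w = (s • w.1, w.2) := fun s w => by simp [T]
  have hTc : Continuous T := by fun_prop
  have hTn : ∀ s ∈ Set.Icc (0 : ℝ) 1, ∀ w, ‖T s w‖ ≤ ‖w‖ := by
    intro s hs w
    rw [hT, Prod.norm_def, Prod.norm_def, norm_smul, Real.norm_of_nonneg hs.1]
    exact max_le_max (mul_le_of_le_one_left (norm_nonneg _) hs.2) le_rfl
  let P : (k : ℕ) → ℝ → ContinuousMultilinearMap ℝ (fun _ : Fin k => X × Y) Z := fun k s =>
    (p k).compContinuousLinearMap fun _ => T s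
  have hPc : ∀ k, Continuous (P k) := fun k =>
    (ContinuousMultilinearMap.compContinuousLinearMapContinuousMultilinear ℝ
      (fun _ : Fin k => X × Y) (fun _ : Fin k => X × Y) Z).cont.clm_apply continuous_const |>.comp
      (continuous_pi fun _ => hTc)
  have hPn : ∀ k, ∀ s ∈ Set.Icc (0 : ℝ) 1, ‖P k s‖ ≤ ‖p k‖ := by
    intro k s hs
    refine ContinuousMultilinearMap.opNorm_le_bound (norm_nonneg _) fun m => ?_
    refine ((p k).le_opNorm _).trans ?_
    gcongr with i
    exact hTn s hs _
  let q : FormalMultilinearSeries ℝ (X × Y) Z := fun k => ∫ s in (0 : ℝ)..1, P k s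
  have hqn : ∀ k, ‖q k‖ ≤ ‖p k‖ := by
    intro k
    have := intervalIntegral.norm_integral_le_of_norm_le_const (a := 0) (b := 1) (f := P k)
      (C := ‖p k‖) fun s hs => hPn k s <| by
        rw [Set.uIoc_of_le zero_le_one] at hs
        exact ⟨hs.1.le, hs.2⟩
    simpa using this
  refine ⟨q, R, ?_, hp.r_pos, ?_⟩
  · refine ENNReal.le_of_forall_nnreal_lt fun t ht => ?_
    obtain ⟨C, -, hC⟩ := p.norm_mul_pow_le_of_lt_radius (ht.trans_le hp.r_le)
    refine q.le_radius_of_bound C fun k => le_trans ?_ (hC k)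
    gcongr
    exact hqn k
  · intro y hy
    have hy' : y ∈ Metric.eball (0 : X × Y) p.radius :=
      Metric.eball_subset_eball hp.r_le hy
    have hmem : ∀ s ∈ Set.Icc (0 : ℝ) 1, T s y ∈ Metric.eball (0 : X × Y) R := by
      intro s hs
      rw [Metric.mem_eball, edist_zero_right] at hy ⊢
      refine lt_of_le_of_lt ?_ hy
      exact enorm_le_iff_norm_le.2 (hTn s hs y)
    have happ : ∀ k, q k (fun _ => y) = ∫ s in (0 : ℝ)..1, p k fun _ => T s y := fun k =>
      ((ContinuousMultilinearMap.apply ℝ (fun _ : Fin k => X × Y) Z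
        fun _ => y).intervalIntegral_comp_comm ((hPc k).intervalIntegrable 0 1)).symm
    simp only [happ, zero_add]
    refine intervalIntegral.hasSum_integral_of_dominated_convergence
      (fun k _ => ‖p k‖ * ‖y‖ ^ k) ?_ ?_ ?_ ?_ ?_
    · intro k
      refine Continuous.aestronglyMeasurable ?_
      exact (p k).cont.comp (continuous_pi fun _ => by fun_prop)
    · intro k
      refine ae_of_all _ fun s hs => ?_
      rw [Set.uIoc_of_le zero_le_one] at hs
      refine ((p k).le_opNorm _).trans ?_
      rw [Finset.prod_const, Finset.card_univ, Fintype.card_fin]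
      gcongr
      exact hTn s ⟨hs.1.le, hs.2⟩ y
    · refine ae_of_all _ fun s _ => ?_
      have : (‖y‖₊ : ENNReal) < p.radius := by
        rwa [Metric.mem_eball, edist_zero_right] at hy'
      have h := p.summable_norm_mul_pow this
      rwa [coe_nnnorm] at h
    · exact intervalIntegrable_const
    · refine ae_of_all _ fun s hs => ?_
      rw [Set.uIoc_of_le zero_le_one] at hs
      have := hp.hasSum (hmem s ⟨hs.1.le, hs.2⟩)
      simpa [hT] using this

/-- The integral is the value at 0 of the convolution of the indicator of (0, 1] with a compactly
supported function depending smoothly on (x, y), and such convolutions are smooth in the parameter.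
-/
theorem smoothNear_integral_scale_infty [CompleteSpace Z] {g : X × Y → Z}
    (hg : SmoothNear ∞ g 0) :
    SmoothNear ∞ (fun p : X × Y => ∫ s in (0 : ℝ)..1, g (s • p.1, p.2)) 0 := by
  obtain ⟨ρ, hρ, hgρ⟩ := Metric.eventually_nhds_iff_ball.1 hg
  let b : ContDiffBump (0 : ℝ) := ⟨1, 2, one_pos, one_lt_two⟩
  -- Convolution at 0 evaluates `G p` at −t, whence the sign. The bump is 1 on [−1, 1] and 0 where
  -- |x| ≥ 2; the radius ρ / 3 used below keeps (−x p₁, p₂) in the ball of radius ρ for |x| < 3.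
  let G : X × Y → ℝ → Z := fun p x => b x • g ((-x) • p.1, p.2)
  have hG : ContDiffOn ℝ ∞ ↿G (Metric.ball (0 : X × Y) (ρ / 3) ×ˢ Set.univ) := by
    rintro ⟨p, x⟩ ⟨hp, -⟩
    refine ContDiffAt.contDiffWithinAt ?_
    rcases lt_or_ge |x| 3 with hx | hx
    · have hmem : ((-x) • p.1, p.2) ∈ Metric.ball (0 : X × Y) ρ := by
        rw [mem_ball_zero_iff] at hp ⊢
        have h1 := norm_fst_le p
        have h2 := norm_snd_le p
        refine max_lt ?_ (by dsimp only; linarith)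
        dsimp only
        rw [norm_smul, norm_neg, Real.norm_eq_abs]
        nlinarith [norm_nonneg p.1, abs_nonneg x]
      have h1 : ContDiffAt ℝ ∞ (fun q : (X × Y) × ℝ => g ((-q.2) • q.1.1, q.1.2)) (p, x) :=
        ContDiffAt.comp (p, x) (g := g) (f := fun q : (X × Y) × ℝ => ((-q.2) • q.1.1, q.1.2))
          (hgρ _ hmem) (by fun_prop)
      exact ((b.contDiff.comp contDiff_snd).contDiffAt).smul h1
    · have : ∀ᶠ q : (X × Y) × ℝ in 𝓝 (p, x), 2 < |q.2| :=
        (continuous_snd.abs.continuousAt).eventually (lt_mem_nhds (by dsimp only; linarith))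
      refine (contDiffAt_const (c := (0 : Z))).congr_of_eventuallyEq ?_
      filter_upwards [this] with q hq
      have : b q.2 = 0 := b.zero_of_le_dist (by
        rw [Real.dist_eq, sub_zero]; exact hq.le)
      simp [G, Function.HasUncurry.uncurry, this]
  have hsupp : ∀ p, ∀ x, p ∈ Metric.ball (0 : X × Y) (ρ / 3) → x ∉ Metric.closedBall (0 : ℝ) 2 →
      G p x = 0 := by
    intro p x _ hx
    have : b x = 0 := b.zero_of_le_dist (by
      rw [Metric.mem_closedBall, not_le] at hx; exact hx.le)
    simp [G, this]
  have hloc : LocallyIntegrable (Set.indicator (Set.Ioc (0 : ℝ) 1) fun _ => (1 : ℝ)) volume :=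
    ((integrable_indicator_iff measurableSet_Ioc).2 (by simp)).locallyIntegrable
  have key := contDiffOn_convolution_right_with_param (ContinuousLinearMap.lsmul ℝ ℝ)
    (n := (⊤ : ℕ∞)) Metric.isOpen_ball (isCompact_closedBall (0 : ℝ) 2) hsupp hloc hG
  have hev : ∀ p : X × Y,
      (convolution (Set.indicator (Set.Ioc (0 : ℝ) 1) fun _ => (1 : ℝ)) (G p)
        (ContinuousLinearMap.lsmul ℝ ℝ) volume) 0 = ∫ s in (0 : ℝ)..1, g (s • p.1, p.2) := by
    intro p
    rw [intervalIntegral.integral_of_le zero_le_one, ← integral_indicator measurableSet_Ioc,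
      convolution_def]
    refine integral_congr_ae (ae_of_all _ fun t => ?_)
    by_cases ht : t ∈ Set.Ioc (0 : ℝ) 1
    · have : b (-t) = 1 := b.one_of_mem_closedBall (by
        rw [mem_closedBall_zero_iff, norm_neg, Real.norm_eq_abs, abs_of_pos ht.1]; exact ht.2)
      simp [ht, G, this]
    · simp [ht]
  filter_upwards [Metric.ball_mem_nhds (0 : X × Y) (by positivity : 0 < ρ / 3)] with p hp
  have h1 := key.contDiffAt (x := (p, (0 : ℝ)))
    ((Metric.isOpen_ball.prod isOpen_univ).mem_nhds ⟨hp, trivial⟩)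
  have h2 := ContDiffAt.comp p (f := fun p : X × Y => (p, (0 : ℝ))) h1 (by fun_prop)
  refine ContDiffAt.congr_of_eventuallyEq h2 (Eventually.of_forall fun p => ?_)
  exact (hev p).symm

/-- Apart from comparisons of orders, only here do the smooth and analytic classes need different
arguments. -/
theorem SmoothNear.integral_scale [CompleteSpace Z] {r : WithTop ℕ∞} (hr : r = ∞ ∨ r = ω)
    {g : X × Y → Z} (hg : SmoothNear r g 0) :
    SmoothNear r (fun p : X × Y => ∫ s in (0 : ℝ)..1, g (s • p.1, p.2)) 0 := by
  rcases hr with rfl | rfl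
  · exact smoothNear_integral_scale_infty hg
  · have h := analyticAt_integral_scale (analyticWithinAt_univ.1
      (contDiffWithinAt_omega_iff_analyticWithinAt.1 (contDiffWithinAt_univ.2 hg.contDiffAt)))
    filter_upwards [h.eventually_analyticAt] with x hx using hx.contDiffAt

end Averages

/-! ### Hadamard's lemma and division by a submersion. -/

section Hadamard

variable {X Y Z : Type*} [NormedAddCommGroup X] [NormedSpace ℝ X]
  [NormedAddCommGroup Y] [NormedSpace ℝ Y] [NormedAddCommGroup Z] [NormedSpace ℝ Z]
  {r : WithTop ℕ∞}

/-- Hadamard's lemma: a `C^r` germ vanishing on `{0} × Y` is a `C^r` multiple of the first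
coordinate. -/
theorem SmoothNear.exists_hadamard [CompleteSpace Z] (hr : r = ∞ ∨ r = ω) {f : X × Y → Z}
    (hf : SmoothNear r f 0) (h0 : ∀ᶠ y in 𝓝 (0 : Y), f (0, y) = 0) :
    ∃ A : X × Y → X →L[ℝ] Z, SmoothNear r A 0 ∧ (∀ᶠ p in 𝓝 (0 : X × Y), f p = A p p.1) ∧
      ∀ y, A (0, y) = (fderiv ℝ f (0, y)).comp (ContinuousLinearMap.inl ℝ X Y) := by
  have hg : SmoothNear r (fun p => (fderiv ℝ f p).comp (ContinuousLinearMap.inl ℝ X Y)) 0 :=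
    (hf.fderiv_right hr).clm_comp (SmoothNear.of_contDiff contDiff_const)
  -- The multiplier is the average of ∂f/∂x along the segment s ↦ (s x, y); at x = 0 the integrand
  -- is constant.
  refine ⟨_, hg.integral_scale hr, ?_, fun y => by simp⟩
  have hn := ne_zero_of_infty_or_omega hr
  obtain ⟨ρ, hρ, hfρ⟩ := Metric.eventually_nhds_iff_ball.1 (hf.and hg)
  have hsnd : Tendsto (fun p : X × Y => p.2) (𝓝 0) (𝓝 0) := continuous_snd.tendsto' _ _ rfl
  filter_upwards [Metric.ball_mem_nhds (0 : X × Y) hρ, hsnd.eventually h0] with p hp hp0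
  have hmem : ∀ s ∈ Set.uIcc (0 : ℝ) 1, (s • p.1, p.2) ∈ Metric.ball (0 : X × Y) ρ := by
    intro s hs
    rw [Set.uIcc_of_le zero_le_one] at hs
    rw [mem_ball_zero_iff] at hp ⊢
    refine max_lt (lt_of_le_of_lt ?_ ((norm_fst_le p).trans_lt hp)) ((norm_snd_le p).trans_lt hp)
    rw [norm_smul, Real.norm_of_nonneg hs.1]
    exact mul_le_of_le_one_left (norm_nonneg _) hs.2
  have hderiv : ∀ s ∈ Set.uIcc (0 : ℝ) 1, HasDerivAt (fun s : ℝ => f (s • p.1, p.2))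
      ((fderiv ℝ f (s • p.1, p.2)).comp (ContinuousLinearMap.inl ℝ X Y) p.1) s := by
    intro s hs
    have h1 : HasDerivAt (fun s : ℝ => (s • p.1, p.2)) (p.1, (0 : Y)) s := by
      simpa using ((hasDerivAt_id s).smul_const p.1).prodMk (hasDerivAt_const s p.2)
    exact ((hfρ _ (hmem s hs)).1.differentiableAt hn).hasFDerivAt.comp_hasDerivAt s h1
  have hcont : ContinuousOn (fun s : ℝ => (fderiv ℝ f (s • p.1, p.2)).comp
      (ContinuousLinearMap.inl ℝ X Y)) (Set.uIcc 0 1) := by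
    intro s hs
    refine ContinuousAt.continuousWithinAt ?_
    exact ContinuousAt.comp (f := fun s : ℝ => (s • p.1, p.2)) (x := s)
      (hfρ _ (hmem s hs)).2.continuousAt (by fun_prop)
  have hint := intervalIntegral.integral_eq_sub_of_hasDerivAt hderiv
    (ContinuousOn.intervalIntegrable (hcont.clm_apply continuousOn_const))
  rw [zero_smul, hp0, one_smul, sub_zero] at hint
  rw [ContinuousLinearMap.intervalIntegral_apply hcont.intervalIntegrable]
  exact hint.symm

/-- Second-order version of Hadamard's lemma. -/
theorem SmoothNear.exists_hadamard_sq [CompleteSpace Z] (hr : r = ∞ ∨ r = ω) {f : X × Y → Z}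
    (hf : SmoothNear r f 0) (h0 : ∀ᶠ y in 𝓝 (0 : Y), f (0, y) = 0)
    (h1 : ∀ᶠ y in 𝓝 (0 : Y), (fderiv ℝ f (0, y)).comp (ContinuousLinearMap.inl ℝ X Y) = 0) :
    ∃ A : X × Y → X →L[ℝ] X →L[ℝ] Z, SmoothNear r A 0 ∧
      ∀ᶠ p in 𝓝 (0 : X × Y), f p = A p p.1 p.1 := by
  obtain ⟨A, hA, hfA, hA0⟩ := hf.exists_hadamard hr h0
  obtain ⟨B, hB, hAB, -⟩ := hA.exists_hadamard hr (h1.mono fun y hy => (hA0 y).trans hy)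
  refine ⟨B, hB, ?_⟩
  filter_upwards [hfA, hAB] with p h2 h3
  rw [h2, h3]

/-- A function whose differential vanishes on the zero set of a submersion `g`, and which vanishes
at the origin, is a quadratic form in `g` with `C^r` coefficients. -/
theorem SmoothNear.exists_quadratic_division [CompleteSpace X] (hr : r = ∞ ∨ r = ω)
    {g : X → Y} (hg : SmoothNear r g 0) (hg0 : g 0 = 0) (S : Y →L[ℝ] X)
    (hS : ∀ y, fderiv ℝ g 0 (S y) = y) {D : X → ℝ} (hD : SmoothNear r D 0) (hD0 : D 0 = 0)
    (hcrit : ∀ᶠ p in 𝓝 (0 : X), g p = 0 → fderiv ℝ D p = 0) :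
    ∃ A : X → Y →L[ℝ] Y →L[ℝ] ℝ, SmoothNear r A 0 ∧
      ∀ᶠ p in 𝓝 (0 : X), D p = A p (g p) (g p) := by
  set T := fderiv ℝ g 0 with hT
  -- A chart tangent to the identity that turns g into its linear part: T ∘ χ = g.
  let χ : X → X := fun p => p - S (T p) + S (g p)
  have hχ : SmoothNear r χ 0 :=
    (SmoothNear.of_contDiff (by fun_prop : ContDiff ℝ r fun p => p - S (T p))).add
      ((SmoothNear.of_contDiff S.contDiff).comp hg rfl)
  have hχ0 : χ 0 = 0 := by simp [χ, hg0]
  have hTχ : ∀ p, T (χ p) = g p := fun p => by simp [χ, hS]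
  have hχ' : HasFDerivAt χ ((ContinuousLinearEquiv.refl ℝ X : X ≃L[ℝ] X) : X →L[ℝ] X) 0 := by
    have h1 : HasFDerivAt (fun p => S (g p)) (S.comp T) 0 :=
      S.hasFDerivAt.comp 0 (hg.differentiableAt hr).hasFDerivAt
    have h2 : HasFDerivAt (fun p => p - S (T p)) (ContinuousLinearMap.id ℝ X - S.comp T) 0 :=
      (ContinuousLinearMap.id ℝ X - S.comp T).hasFDerivAt
    have h3 := h2.add h1
    rw [sub_add_cancel] at h3
    exact h3
  obtain ⟨ψ, hψ0, hψ, hψχ, hχψ⟩ := hχ.exists_local_inverse hr hχ0 _ hχ'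
  -- The point with T-component y and the kernel component of z. Letting z range over all of X, with
  -- redundancy, avoids splitting X; {0} × X lands in ker T, which ψ carries to the zero set of g.
  let k : Y × X → X := fun q => q.2 - S (T q.2) + S q.1
  have hk : ContDiff ℝ r k := by fun_prop
  have hk0 : k 0 = 0 := by simp [k]
  let f : Y × X → ℝ := fun q => D (ψ (k q))
  have hf : SmoothNear r f 0 :=
    hD.comp (hψ.comp (SmoothNear.of_contDiff hk) hk0) (by rw [hk0, hψ0])
  have hinr : Tendsto (fun z : X => k ((0 : Y), z)) (𝓝 0) (𝓝 0) :=
    (by fun_prop : Continuous fun z : X => k ((0 : Y), z)).tendsto' _ _ hk0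
  have hTk : ∀ z, T (k (0, z)) = 0 := fun z => by simp [k, hS]
  have hf' : ∀ᶠ z in 𝓝 (0 : X), HasFDerivAt f (0 : Y × X →L[ℝ] ℝ) (0, z) := by
    have hψt := hψ.tendsto hψ0
    filter_upwards [hinr.eventually (hψt.eventually hcrit), hinr.eventually hχψ,
      hinr.eventually (hψ.eventually_differentiableAt hr),
      hinr.eventually (hψt.eventually (hD.eventually_differentiableAt hr))] with z h1 h2 h3 h4
    have hgz : g (ψ (k (0, z))) = 0 := by rw [← hTχ, h2, hTk]
    have h5 := h4.hasFDerivAt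
    rw [h1 hgz] at h5
    have h6 : DifferentiableAt ℝ (fun q => ψ (k q)) ((0 : Y), z) :=
      DifferentiableAt.comp (g := ψ) _ h3
        (hk.contDiffAt.differentiableAt (ne_zero_of_infty_or_omega hr))
    have h7 := HasFDerivAt.comp ((0 : Y), z) h5 h6.hasFDerivAt
    rw [ContinuousLinearMap.zero_comp] at h7
    exact h7
  -- A zero derivative on a ball makes f(0, ·) constant there, equal to D(0) = 0.
  have hf0 : ∀ᶠ z in 𝓝 (0 : X), f (0, z) = 0 := by
    obtain ⟨ρ, hρ, hfρ⟩ := Metric.eventually_nhds_iff_ball.1 hf'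
    filter_upwards [Metric.ball_mem_nhds (0 : X) hρ] with z hz
    have hd : ∀ w ∈ Metric.ball (0 : X) ρ,
        HasFDerivWithinAt (fun z : X => f ((0 : Y), z)) (0 : X →L[ℝ] ℝ) (Metric.ball 0 ρ) w := by
      intro w hw
      have := (hfρ w hw).comp w (hasFDerivAt_prodMk_right (0 : Y) w)
      rw [ContinuousLinearMap.zero_comp] at this
      exact this.hasFDerivWithinAt
    have := (convex_ball (0 : X) ρ).norm_image_sub_le_of_norm_hasFDerivWithin_le (C := 0) hd
      (by simp) (Metric.mem_ball_self hρ) hz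
    have h00 : f ((0 : Y), (0 : X)) = 0 := by simp [f, k, hψ0, hD0]
    simpa [h00] using this
  obtain ⟨A, hA, hfA⟩ := hf.exists_hadamard_sq hr hf0
    (hf'.mono fun z hz => by rw [hz.fderiv]; rfl)
  have hgχ : SmoothNear r (fun p => (g p, χ p)) 0 := hg.prodMk hχ
  have hgχ0 : (g 0, χ 0) = 0 := by simp [hg0, hχ0]
  refine ⟨fun p => A (g p, χ p), hA.comp hgχ hgχ0, ?_⟩
  filter_upwards [(hgχ.tendsto hgχ0).eventually hfA, hψχ] with p h1 h2
  rw [← h1]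
  have : k (g p, χ p) = χ p := by simp [k, hTχ]
  simp only [f, this, h2]

end Hadamard

/-! ### Partial gradients and odd families. -/

section Gradients

variable {n m : ℕ} {r : WithTop ℕ∞}

/-- The components along `β` of a covector. -/
noncomputable def varPart (n m : ℕ) : (BigSpace n m →L[ℝ] ℝ) →L[ℝ] (Fin n → ℝ) :=
  ContinuousLinearMap.pi fun i =>
    ContinuousLinearMap.apply ℝ ℝ ((Pi.single i 1, 0) : BigSpace n m)

/-- The components along `λ` of a covector. -/
noncomputable def parPart (n m : ℕ) : (BigSpace n m →L[ℝ] ℝ) →L[ℝ] (Fin m → ℝ) :=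
  ContinuousLinearMap.pi fun i =>
    ContinuousLinearMap.apply ℝ ℝ ((0, Pi.single i 1) : BigSpace n m)

theorem gradVar_eq (F : BigSpace n m → ℝ) (p : BigSpace n m) :
    gradVar F p = varPart n m (fderiv ℝ F p) := rfl

theorem gradPar_eq (F : BigSpace n m → ℝ) (p : BigSpace n m) :
    gradPar F p = parPart n m (fderiv ℝ F p) := rfl

theorem dotProduct_eq_of_linear {k : ℕ} (φ : (Fin k → ℝ) →L[ℝ] ℝ) (b : Fin k → ℝ) :
    dotProduct (fun i => φ (Pi.single i 1)) b = φ b := by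
  conv_rhs => rw [← Finset.univ_sum_single b, map_sum]
  refine Finset.sum_congr rfl fun i _ => ?_
  have : (Pi.single i (b i) : Fin k → ℝ) = b i • Pi.single i (1 : ℝ) := by
    rw [← Pi.single_smul, smul_eq_mul, mul_one]
  rw [this, map_smul, smul_eq_mul, mul_comm]

theorem varPart_dotProduct (φ : BigSpace n m →L[ℝ] ℝ) (b : Fin n → ℝ) :
    dotProduct (varPart n m φ) b = φ (b, 0) :=
  dotProduct_eq_of_linear (φ.comp (ContinuousLinearMap.inl ℝ _ _)) b

theorem parPart_dotProduct (φ : BigSpace n m →L[ℝ] ℝ) (l : Fin m → ℝ) :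
    dotProduct (parPart n m φ) l = φ (0, l) :=
  dotProduct_eq_of_linear (φ.comp (ContinuousLinearMap.inr ℝ _ _)) l

theorem eq_of_dotProduct_eq {k : ℕ} {v w : Fin k → ℝ}
    (h : ∀ b, dotProduct v b = dotProduct w b) : v = w := by
  ext i
  simpa using h (Pi.single i 1)

theorem varPart_eq_zero_iff (φ : BigSpace n m →L[ℝ] ℝ) :
    varPart n m φ = 0 ↔ ∀ b, φ (b, 0) = 0 := by
  constructor
  · intro h b
    rw [← varPart_dotProduct, h, zero_dotProduct]
  · intro h
    exact eq_of_dotProduct_eq fun b => by rw [varPart_dotProduct, h, zero_dotProduct]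

/-- The reflection `(β, λ) ↦ (-β, λ)`. -/
noncomputable def reflectVar (n m : ℕ) : BigSpace n m →L[ℝ] BigSpace n m :=
  (-ContinuousLinearMap.fst ℝ _ _).prod (ContinuousLinearMap.snd ℝ _ _)

@[simp] theorem reflectVar_apply (p : BigSpace n m) : reflectVar n m p = (-p.1, p.2) := rfl

theorem tendsto_reflectVar : Tendsto (reflectVar n m) (𝓝 0) (𝓝 0) :=
  (reflectVar n m).continuous.tendsto' _ _ (map_zero _)

theorem SmoothNear.gradVar (hr : r = ∞ ∨ r = ω) {F : BigSpace n m → ℝ} {a : BigSpace n m}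
    (hF : SmoothNear r F a) : SmoothNear r (gradVar F) a :=
  (SmoothNear.of_contDiff (varPart n m).contDiff).comp (hF.fderiv_right hr) rfl

theorem SmoothNear.gradPar (hr : r = ∞ ∨ r = ω) {F : BigSpace n m → ℝ} {a : BigSpace n m}
    (hF : SmoothNear r F a) : SmoothNear r (gradPar F) a :=
  (SmoothNear.of_contDiff (parPart n m).contDiff).comp (hF.fderiv_right hr) rfl

theorem fderiv_gradVar (hr : r = ∞ ∨ r = ω) {F : BigSpace n m → ℝ}
    (hF : SmoothNear r F 0) (v : BigSpace n m) :
    fderiv ℝ (gradVar F) 0 v = varPart n m (fderiv ℝ (fderiv ℝ F) 0 v) := by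
  have := (varPart n m).hasFDerivAt.comp (0 : BigSpace n m)
    ((hF.fderiv_right hr).differentiableAt hr).hasFDerivAt
  exact congrArg (fun φ => φ v) this.fderiv

theorem fderiv_gradPar (hr : r = ∞ ∨ r = ω) {F : BigSpace n m → ℝ}
    (hF : SmoothNear r F 0) (v : BigSpace n m) :
    fderiv ℝ (gradPar F) 0 v = parPart n m (fderiv ℝ (fderiv ℝ F) 0 v) := by
  have := (parPart n m).hasFDerivAt.comp (0 : BigSpace n m)
    ((hF.fderiv_right hr).differentiableAt hr).hasFDerivAt
  exact congrArg (fun φ => φ v) this.fderiv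

/-- A germ of a family odd in `β`, critical at the origin, with independent `∂F/∂βᵢ`. -/
structure IsOddFamily (r : WithTop ℕ∞) (F : BigSpace n m → ℝ) : Prop where
  smooth : SmoothNear r F 0
  odd : ∀ᶠ p in 𝓝 (0 : BigSpace n m), F (-p.1, p.2) = -F p
  critical : gradVar F 0 = 0
  surjective : Function.Surjective (fderiv ℝ (gradVar F) 0)

namespace IsOddFamily

variable {F : BigSpace n m → ℝ}

theorem fderiv_reflectVar (hF : IsOddFamily r F) (hr : r = ∞ ∨ r = ω) :
    ∀ᶠ p in 𝓝 (0 : BigSpace n m), ∀ w,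
      fderiv ℝ F (-p.1, p.2) (-w.1, w.2) = -fderiv ℝ F p w := by
  filter_upwards [hF.odd.eventually_nhds,
    tendsto_reflectVar.eventually (hF.smooth.eventually_differentiableAt hr)] with p h1 h2 w
  have h3 : (fun q => F (reflectVar n m q)) =ᶠ[𝓝 p] fun q => -F q := h1
  have h4 := h3.fderiv_eq (𝕜 := ℝ)
  have h5 : fderiv ℝ (fun q => F (reflectVar n m q)) p
      = (fderiv ℝ F (reflectVar n m p)).comp (reflectVar n m) :=
    (HasFDerivAt.comp p h2.hasFDerivAt (reflectVar n m).hasFDerivAt).fderiv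
  rw [h5, fderiv_fun_neg] at h4
  exact DFunLike.congr_fun h4 w

theorem gradVar_even (hF : IsOddFamily r F) (hr : r = ∞ ∨ r = ω) :
    ∀ᶠ p in 𝓝 (0 : BigSpace n m), gradVar F (-p.1, p.2) = gradVar F p := by
  filter_upwards [hF.fderiv_reflectVar hr] with p h
  refine eq_of_dotProduct_eq fun b => ?_
  rw [gradVar_eq, gradVar_eq, varPart_dotProduct, varPart_dotProduct]
  have h1 := h (-b, 0)
  have h2 : ((-b, 0) : BigSpace n m) = -(b, 0) := by simp
  simp only [neg_neg] at h1
  rw [h1, h2, map_neg, neg_neg]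

theorem gradPar_odd (hF : IsOddFamily r F) (hr : r = ∞ ∨ r = ω) :
    ∀ᶠ p in 𝓝 (0 : BigSpace n m), gradPar F (-p.1, p.2) = -gradPar F p := by
  filter_upwards [hF.fderiv_reflectVar hr] with p h
  refine eq_of_dotProduct_eq fun l => ?_
  rw [neg_dotProduct, gradPar_eq, gradPar_eq, parPart_dotProduct, parPart_dotProduct]
  simpa using h (0, l)

theorem gradPar_eq_zero (hF : IsOddFamily r F) (hr : r = ∞ ∨ r = ω) :
    ∀ᶠ l in 𝓝 (0 : Fin m → ℝ), gradPar F (0, l) = 0 := by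
  have ht : Tendsto (fun l : Fin m → ℝ => ((0, l) : BigSpace n m)) (𝓝 0) (𝓝 0) :=
    (Continuous.prodMk_right (0 : Fin n → ℝ)).tendsto' _ _ rfl
  filter_upwards [ht.eventually (hF.gradPar_odd hr)] with l hl
  rw [neg_zero] at hl
  exact self_eq_neg.1 hl

theorem gradPar_zero (hF : IsOddFamily r F) (hr : r = ∞ ∨ r = ω) : gradPar F 0 = 0 :=
  (hF.gradPar_eq_zero hr).self_of_nhds

/-- The gradient ∂F/∂β is even in β, so the block ∂²F/∂β² vanishes at the origin. The directions (b,
0) are therefore tangent to the critical set. -/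
theorem fderiv_gradVar_inl (hF : IsOddFamily r F) (hr : r = ∞ ∨ r = ω) (b : Fin n → ℝ) :
    fderiv ℝ (gradVar F) 0 (b, 0) = 0 := by
  have h1 : (fun p => gradVar F (reflectVar n m p)) =ᶠ[𝓝 0] gradVar F := hF.gradVar_even hr
  have h2 : DifferentiableAt ℝ (gradVar F) (reflectVar n m 0) := by
    rw [map_zero]; exact (hF.smooth.gradVar hr).differentiableAt hr
  have h3 : fderiv ℝ (fun p => gradVar F (reflectVar n m p)) 0
      = (fderiv ℝ (gradVar F) (reflectVar n m 0)).comp (reflectVar n m) :=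
    (HasFDerivAt.comp 0 h2.hasFDerivAt (reflectVar n m).hasFDerivAt).fderiv
  rw [h1.fderiv_eq, map_zero] at h3
  have h4 := congrArg (fun φ => φ (b, 0)) h3
  have h5 : reflectVar n m (b, 0) = -(b, 0) := by simp
  simp only [ContinuousLinearMap.comp_apply, h5, map_neg] at h4
  exact self_eq_neg.1 h4

/-- With the ββ-block zero, surjectivity of d(∂F/∂β) rests on the mixed block B alone; the transpose
of a surjective B is injective. -/
theorem gradPar_injective (hF : IsOddFamily r F) (hr : r = ∞ ∨ r = ω) {b : Fin n → ℝ}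
    (hb : fderiv ℝ (gradPar F) 0 (b, 0) = 0) : b = 0 := by
  obtain ⟨⟨b', l⟩, hl⟩ := hF.surjective b
  have h1 : fderiv ℝ (gradVar F) 0 (0, l) = b := by
    have : ((b', l) : BigSpace n m) = (b', 0) + (0, l) := by simp
    rwa [this, map_add, hF.fderiv_gradVar_inl hr, zero_add] at hl
  have hsymm : IsSymmSndFDerivAt ℝ F 0 := by
    refine hF.smooth.contDiffAt.isSymmSndFDerivAt ?_
    rw [minSmoothness_of_isRCLikeNormedField]
    rcases hr with rfl | rfl
    · exact WithTop.coe_le_coe.2 (le_top : (2 : ℕ∞) ≤ ⊤)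
    · exact le_top
  -- Writing b = B l gives b · b = (B l) · b = l · (Bᵀ b) = 0, by symmetry of the second derivative.
  have h2 : dotProduct b b = 0 := by
    nth_rewrite 1 [← h1]
    rw [fderiv_gradVar hr hF.smooth, varPart_dotProduct, hsymm.eq, ← parPart_dotProduct,
      ← fderiv_gradPar hr hF.smooth, hb, zero_dotProduct]
  exact dotProduct_self_eq_zero.1 h2

end IsOddFamily

/-- Modulo {α = 0} only the α-component of the section survives, so transversality says that
d(∂F/∂β) is onto. -/
theorem IsOddGeneratingFamily.isOddFamily (hr : r = ∞ ∨ r = ω) {F : BigSpace n m → ℝ}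
    {L : Set (PhaseSpace m)} (hF : IsOddGeneratingFamily r F L) : IsOddFamily r F := by
  have hs := isSmoothGerm_iff.1 hF.smooth
  refine ⟨hs, hF.odd, hF.regular.1, fun y => ?_⟩
  have htop : (((y, 0), 0) : BigPhaseSpace n m) ∈ (⊤ : Submodule ℝ (BigPhaseSpace n m)) :=
    trivial
  rw [← hF.regular.2] at htop
  obtain ⟨_, ⟨v, rfl⟩, w, hw, hvw⟩ := Submodule.mem_sup.1 htop
  have hw' : w.1.1 = 0 := hw
  refine ⟨v, ?_⟩
  have h1 := ((hs.gradVar hr).differentiableAt hr).hasFDerivAt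
  have h2 := ((hs.gradPar hr).differentiableAt hr).hasFDerivAt
  have h3 : HasFDerivAt (lagrangianSection F) _ 0 := (h1.prodMk h2).prodMk (hasFDerivAt_id 0)
  rw [h3.fderiv] at hvw
  have := congrArg (fun z : BigPhaseSpace n m => z.1.1) hvw
  simpa [hw'] using this

end Gradients

/-! ### Absorbing an odd quadratic perturbation into the variables β. -/

theorem eq_zero_of_eq_neg {E : Type*} [AddCommGroup E] [Module ℝ E] {x : E} (h : x = -x) :
    x = 0 := by
  have h1 : (2 : ℝ) • x = 0 := by
    rw [two_smul]
    nth_rewrite 2 [h]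
    exact add_neg_cancel x
  exact (smul_eq_zero.1 h1).resolve_left two_ne_zero

/-- Solution of `w + H (w, p) = a p` for `w`, when `H` vanishes to second order at the origin. -/
theorem exists_implicit_solution {W E : Type*} [NormedAddCommGroup W] [NormedSpace ℝ W]
    [CompleteSpace W] [NormedAddCommGroup E] [NormedSpace ℝ E] [CompleteSpace E]
    {r : WithTop ℕ∞} (hr : r = ∞ ∨ r = ω) {H : W × E → W} (hH : SmoothNear r H 0) (hH0 : H 0 = 0)
    (hH' : HasFDerivAt H (0 : W × E →L[ℝ] W) 0) {a : E → W} (ha : SmoothNear r a 0)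
    (ha0 : a 0 = 0) :
    ∃ s : E → W, SmoothNear r s 0 ∧ s 0 = 0 ∧ (∀ᶠ p in 𝓝 (0 : E), s p + H (s p, p) = a p) ∧
      ∀ᶠ x in 𝓝 (0 : W × E), x.1 + H x = a x.2 → x.1 = s x.2 := by
  have hfst : SmoothNear r (fun x : W × E => x.1) 0 := SmoothNear.of_contDiff contDiff_fst
  have hsnd : SmoothNear r (fun x : W × E => x.2) 0 := SmoothNear.of_contDiff contDiff_snd
  -- The derivative of this map at 0 is triangular, because H has zero derivative there. The
  -- solution is the first component of the inverse at (0, p), and injectivity gives the local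
  -- uniqueness.
  let G : W × E → W × E := fun x => (x.1 + H x - a x.2, x.2)
  have hG : SmoothNear r G 0 := ((hfst.add hH).sub (ha.comp hsnd rfl)).prodMk hsnd
  have hG0 : G 0 = 0 := by simp [G, ha0, hH0]
  let N : E →L[ℝ] W := fderiv ℝ a 0
  let G' : (W × E) ≃L[ℝ] (W × E) :=
    ContinuousLinearEquiv.equivOfInverse
      ((ContinuousLinearMap.fst ℝ _ _ - N.comp (ContinuousLinearMap.snd ℝ _ _)).prod
        (ContinuousLinearMap.snd ℝ _ _))
      ((ContinuousLinearMap.fst ℝ _ _ + N.comp (ContinuousLinearMap.snd ℝ _ _)).prod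
        (ContinuousLinearMap.snd ℝ _ _))
      (fun x => by simp) (fun x => by simp)
  have hG' : HasFDerivAt G (G' : (W × E) →L[ℝ] (W × E)) 0 := by
    have h1 : HasFDerivAt (fun x : W × E => x.1) (ContinuousLinearMap.fst ℝ _ _) 0 :=
      hasFDerivAt_fst
    have h2 : HasFDerivAt (fun x : W × E => x.2) (ContinuousLinearMap.snd ℝ _ _) 0 :=
      hasFDerivAt_snd
    have h4 : HasFDerivAt (fun x : W × E => a x.2) (N.comp (ContinuousLinearMap.snd ℝ _ _)) 0 :=
      HasFDerivAt.comp (g := a) (0 : W × E) (ha.differentiableAt hr).hasFDerivAt h2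
    have h5 := ((h1.add hH').sub h4).prodMk h2
    rw [add_zero] at h5
    exact h5
  obtain ⟨I, hI0, hI, hIG, hGI⟩ := hG.exists_local_inverse hr hG0 G' hG'
  have hinr : ContDiff ℝ r fun p : E => ((0 : W), p) := by fun_prop
  have hinrt : Tendsto (fun p : E => ((0 : W), p)) (𝓝 0) (𝓝 0) :=
    hinr.continuous.tendsto' _ _ rfl
  refine ⟨fun p => (I (0, p)).1,
    (SmoothNear.of_contDiff contDiff_fst).comp (hI.comp (SmoothNear.of_contDiff hinr) rfl) rfl,
    congrArg Prod.fst hI0, ?_, ?_⟩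
  · filter_upwards [hinrt.eventually hGI] with p hp
    have h2 : (I (0, p)).2 = p := congrArg Prod.snd hp
    have h3 : I (0, p) = ((I (0, p)).1, p) := Prod.ext rfl h2
    have h1 := congrArg Prod.fst hp
    rw [h3] at h1
    exact sub_eq_zero.1 h1
  · filter_upwards [hIG] with x hx h
    have h1 : G x = (0, x.2) := Prod.ext (sub_eq_zero.2 h) rfl
    rw [h1] at hx
    exact (congrArg Prod.fst hx).symm

section OddPerturbation

variable {n m : ℕ} {r : WithTop ℕ∞}

/-- Second-order Taylor expansion in `β` of an odd family, with an odd `C^r` remainder. -/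
theorem IsOddFamily.exists_taylor {F : BigSpace n m → ℝ} (hF : IsOddFamily r F)
    (hr : r = ∞ ∨ r = ω) :
    ∃ Q : (Fin n → ℝ) × BigSpace n m → (Fin n → ℝ) →L[ℝ] (Fin n → ℝ) →L[ℝ] ℝ,
      SmoothNear r Q 0 ∧ (∀ h p, Q (-h, (-p.1, p.2)) = -Q (h, p)) ∧
      ∀ᶠ q in 𝓝 (0 : (Fin n → ℝ) × BigSpace n m),
        F (q.2.1 + q.1, q.2.2) = F q.2 + dotProduct (gradVar F q.2) q.1 + Q q q.1 q.1 := by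
  have hsum : ContDiff ℝ r fun q : (Fin n → ℝ) × BigSpace n m => (q.2.1 + q.1, q.2.2) := by
    fun_prop
  let f : (Fin n → ℝ) × BigSpace n m → ℝ := fun q =>
    F (q.2.1 + q.1, q.2.2) - F q.2 - fderiv ℝ F q.2 (q.1, 0)
  have hf : SmoothNear r f 0 := by
    refine ((hF.smooth.comp (SmoothNear.of_contDiff hsum) (by simp)).sub
      (hF.smooth.comp (SmoothNear.of_contDiff contDiff_snd) rfl)).sub ?_
    exact ((hF.smooth.fderiv_right hr).comp (SmoothNear.of_contDiff contDiff_snd) rfl).clm_apply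
      (SmoothNear.of_contDiff (by fun_prop))
  have hf0 : ∀ p, f (0, p) = 0 := fun p => by
    have h0 : (((0 : Fin n → ℝ), (0 : Fin m → ℝ)) : BigSpace n m) = 0 := rfl
    simp [f, h0]
  have hf1 : ∀ᶠ p in 𝓝 (0 : BigSpace n m),
      (fderiv ℝ f (0, p)).comp (ContinuousLinearMap.inl ℝ _ _) = 0 := by
    have ht : Tendsto (fun p : BigSpace n m => ((0 : Fin n → ℝ), p)) (𝓝 0) (𝓝 0) :=
      (Continuous.prodMk_right _).tendsto' _ _ rfl
    filter_upwards [hF.smooth.eventually_differentiableAt hr,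
      ht.eventually (hf.eventually_differentiableAt hr)] with p h1 h2
    have h3 : HasFDerivAt (fun h : Fin n → ℝ => f (h, p))
        ((fderiv ℝ f (0, p)).comp (ContinuousLinearMap.inl ℝ _ _)) 0 :=
      HasFDerivAt.comp (g := f) (0 : Fin n → ℝ) h2.hasFDerivAt (hasFDerivAt_prodMk_left 0 p)
    have h4 : HasFDerivAt (fun h : Fin n → ℝ => F (p.1 + h, p.2))
        ((fderiv ℝ F p).comp (ContinuousLinearMap.inl ℝ _ _)) 0 := by
      have h5 : HasFDerivAt (fun h : Fin n → ℝ => ((p.1 + h, p.2) : BigSpace n m))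
          (ContinuousLinearMap.inl ℝ _ _) 0 :=
        ((hasFDerivAt_id (0 : Fin n → ℝ)).const_add p.1).prodMk (hasFDerivAt_const p.2 _)
      refine HasFDerivAt.comp (g := F) (0 : Fin n → ℝ) ?_ h5
      simpa using h1.hasFDerivAt
    have h6 : HasFDerivAt (fun h : Fin n → ℝ => fderiv ℝ F p (h, 0))
        ((fderiv ℝ F p).comp (ContinuousLinearMap.inl ℝ _ _)) 0 :=
      ((fderiv ℝ F p).comp (ContinuousLinearMap.inl ℝ _ _)).hasFDerivAt
    have h7 := (h4.sub_const (F p)).sub h6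
    rw [sub_self] at h7
    exact h3.unique h7
  obtain ⟨Q, hQ, hfQ⟩ := hf.exists_hadamard_sq hr (Eventually.of_forall hf0) hf1
  let ρ : (Fin n → ℝ) × BigSpace n m →L[ℝ] (Fin n → ℝ) × BigSpace n m :=
    (-ContinuousLinearMap.fst ℝ _ _).prod ((reflectVar n m).comp (ContinuousLinearMap.snd ℝ _ _))
  have hρ : ∀ q, ρ q = (-q.1, (-q.2.1, q.2.2)) := fun q => rfl
  have hρt : Tendsto ρ (𝓝 0) (𝓝 0) := ρ.continuous.tendsto' _ _ (map_zero _)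
  have hsndt : Tendsto (fun q : (Fin n → ℝ) × BigSpace n m => q.2) (𝓝 0) (𝓝 0) :=
    continuous_snd.tendsto' _ _ rfl
  -- The remainder is odd under (h, β) ↦ (−h, −β), so it survives replacing Q by its odd part.
  refine ⟨fun q => (1 / 2 : ℝ) • (Q q - Q (ρ q)), ?_, ?_, ?_⟩
  · have h1 : SmoothNear r (fun q => Q q - Q (ρ q)) 0 :=
      hQ.sub (hQ.comp (SmoothNear.of_contDiff ρ.contDiff) (map_zero _))
    filter_upwards [h1] with q hq using hq.const_smul _
  · intro h p
    simp only [hρ, neg_neg, Prod.mk.eta]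
    exact (congrArg _ (neg_sub _ _).symm).trans (smul_neg _ _)
  · filter_upwards [hfQ, hρt.eventually hfQ, hsndt.eventually hF.odd,
      (hsum.continuous.tendsto' 0 0 (by simp)).eventually hF.odd,
      hsndt.eventually (hF.fderiv_reflectVar hr)] with q h1 h2 h3 h4 h5
    have h6 : f (ρ q) = - f q := by
      simp only [f, hρ]
      have h7 := h5 (q.1, 0)
      rw [neg_add] at h4
      rw [h4, h3]
      dsimp only at h7 ⊢
      rw [h7]
      ring
    rw [h6] at h2
    simp only [hρ, map_neg, neg_apply, neg_neg] at h2
    simp only [smul_apply, sub_apply, hρ, smul_eq_mul]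
    rw [gradVar_eq, varPart_dotProduct]
    simp only [f] at h1 h2
    linarith

/-- The linear endomorphisms of the space of the variables `β`. -/
abbrev EndVar (n : ℕ) : Type := (Fin n → ℝ) →L[ℝ] (Fin n → ℝ)

set_option maxHeartbeats 1000000 in
/-- An odd perturbation of an odd family by a quadratic form in `∂F/∂β` is induced by a change of
the variables `β`. -/
theorem IsOddFamily.exists_reparametrisation {F : BigSpace n m → ℝ} (hF : IsOddFamily r F)
    (hr : r = ∞ ∨ r = ω) {A : BigSpace n m → (Fin n → ℝ) →L[ℝ] (Fin n → ℝ) →L[ℝ] ℝ}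
    (hA : SmoothNear r A 0) (hodd : ∀ p, A (-p.1, p.2) = -A p) :
    ∃ s : BigSpace n m → EndVar n, SmoothNear r s 0 ∧ s 0 = 0 ∧
      (∀ᶠ p in 𝓝 (0 : BigSpace n m), s (-p.1, p.2) = -s p) ∧
      ∀ᶠ p in 𝓝 (0 : BigSpace n m), F (p.1 + s p (gradVar F p), p.2) =
        F p + A p (gradVar F p) (gradVar F p) := by
  obtain ⟨Q, hQ, hQodd, hFQ⟩ := hF.exists_taylor hr
  have hv := hF.smooth.gradVar hr
  have hQ0 : Q 0 = 0 := by
    have := hQodd 0 0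
    have h0 : ((-(0 : Fin n → ℝ), (-(0 : BigSpace n m).1, (0 : BigSpace n m).2)) :
      (Fin n → ℝ) × BigSpace n m) = 0 := by simp
    rw [h0] at this
    exact eq_zero_of_eq_neg (E := (Fin n → ℝ) →L[ℝ] (Fin n → ℝ) →L[ℝ] ℝ) this
  -- Oddness makes the perturbation vanish at the origin, which is what permits a solution with s(0)
  -- = 0.
  have hA0 : A 0 = 0 := by
    have := hodd 0
    have h0 : ((-(0 : BigSpace n m).1, (0 : BigSpace n m).2) : BigSpace n m) = 0 := by simp
    rw [h0] at this
    exact eq_zero_of_eq_neg (E := (Fin n → ℝ) →L[ℝ] (Fin n → ℝ) →L[ℝ] ℝ) this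
  let K : ((Fin n → ℝ) →L[ℝ] (Fin n → ℝ) →L[ℝ] ℝ) → EndVar n := fun B =>
    ContinuousLinearMap.pi fun i => B (Pi.single i 1)
  let KL : ((Fin n → ℝ) →L[ℝ] (Fin n → ℝ) →L[ℝ] ℝ) →L[ℝ] EndVar n :=
    LinearMap.toContinuousLinearMap
      { toFun := K
        map_add' := fun B B' => rfl
        map_smul' := fun c B => rfl }
  have hKL : ∀ B, KL B = K B := fun B => rfl
  let c : EndVar n × BigSpace n m → (Fin n → ℝ) × BigSpace n m := fun x => (x.1 (gradVar F x.2), x.2)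
  have hc : SmoothNear r c 0 :=
    ((SmoothNear.of_contDiff contDiff_fst).clm_apply
      (hv.comp (SmoothNear.of_contDiff contDiff_snd) rfl)).prodMk
      (SmoothNear.of_contDiff contDiff_snd)
  have hc0 : c 0 = 0 := by simp [c]
  have hQc : SmoothNear r (fun x => Q (c x)) 0 := hQ.comp hc hc0
  have hKdot : ∀ B w v, dotProduct v (K B w) = B v w := fun B w v => by
    rw [dotProduct_comm]
    exact dotProduct_eq_of_linear (B.flip w) v
  -- With h = s v in the Taylor expansion, the goal is v · s v + Q(s v, s v) = A(v, v). Since v ·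
  -- K(B) w = B(v, w), it follows from the operator equation s + d ∘ s = K(A). As d vanishes at the
  -- origin, d ∘ s is of second order.
  let d : EndVar n × BigSpace n m → EndVar n := fun x => KL ((Q (c x)).comp x.1)
  have hfst : SmoothNear r (fun x : EndVar n × BigSpace n m => x.1) 0 :=
    SmoothNear.of_contDiff contDiff_fst
  have hd : SmoothNear r d 0 := (hQc.clm_comp hfst).continuousLinearMap_comp KL
  have hd0 : d 0 = 0 := by simp [d]
  have hKA : SmoothNear r (fun p => KL (A p)) 0 :=
    hA.continuousLinearMap_comp KL
  have hH : SmoothNear r (fun x => (d x).comp x.1) 0 :=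
    hd.clm_comp hfst
  have hH' : HasFDerivAt (fun x : EndVar n × BigSpace n m => (d x).comp x.1)
      (0 : (EndVar n × BigSpace n m) →L[ℝ] EndVar n) 0 := by
    have := (hd.differentiableAt hr).hasFDerivAt.clm_comp
      (hasFDerivAt_fst (𝕜 := ℝ) (p := (0 : EndVar n × BigSpace n m)))
    rw [hd0] at this
    simpa using this
  obtain ⟨s, hs, hs0, hsol, huniq⟩ := exists_implicit_solution hr hH (by simp) hH' hKA
    (by rw [hA0, map_zero])
  have hst : Tendsto (fun p => (s p, p)) (𝓝 0) (𝓝 0) :=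
    (hs.prodMk (SmoothNear.of_contDiff contDiff_id)).tendsto (by simp [hs0])
  refine ⟨s, hs, hs0, ?_, ?_⟩
  -- The value −s(−β, λ) solves the equation at (β, λ): the signs from Q and from s cancel in d.
  -- Local uniqueness identifies it with s(β, λ).
  · have hx : Tendsto (fun p : BigSpace n m => (-s (reflectVar n m p), p)) (𝓝 0) (𝓝 0) := by
      have h1 := ((hs.tendsto hs0).comp tendsto_reflectVar).neg
      rw [neg_zero] at h1
      exact h1.prodMk_nhds tendsto_id
    filter_upwards [hx.eventually huniq, tendsto_reflectVar.eventually hsol,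
      hF.gradVar_even hr] with p h1 h3 h4
    have h5 : d (-s (reflectVar n m p), p) = d (s (reflectVar n m p), reflectVar n m p) := by
      have h6 : c (-s (reflectVar n m p), p)
          = (-(s (reflectVar n m p) (gradVar F p)), p) := rfl
      have h7 : c (s (reflectVar n m p), reflectVar n m p)
          = (s (reflectVar n m p) (gradVar F p), (-p.1, p.2)) := by
        simp only [c, reflectVar_apply, h4]
      have h8 := hQodd (s (reflectVar n m p) (gradVar F p)) (-p.1, p.2)
      simp only [neg_neg, Prod.mk.eta] at h8
      simp only [d, h6, h7, h8]
      congr 1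
      ext; simp
    have h10 := h3
    rw [reflectVar_apply, hodd] at h10
    have h12 : KL (-A p) = -KL (A p) := map_neg KL _
    rw [h12] at h10
    have h11 := h1 (by
      simp only [h5]
      simp only [reflectVar_apply]
      rw [ContinuousLinearMap.comp_neg, ← neg_add, h10, neg_neg])
    simp only [reflectVar_apply] at h11
    rw [← h11, neg_neg]
  · filter_upwards [hsol, (hc.tendsto hc0).comp hst |>.eventually hFQ] with p h1 h2
    have h3 := congrArg (fun S : EndVar n => dotProduct (gradVar F p) (S (gradVar F p))) h1
    simp only [hKL, hKdot] at h3
    rw [← h3]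
    simp only [Function.comp_apply, c] at h2
    rw [h2]
    have h4 := hKdot ((Q (s p (gradVar F p), p)).comp (s p)) (s p (gradVar F p)) (gradVar F p)
    rw [add_assoc]
    congr 1
    rw [add_apply, dotProduct_add]
    congr 1
    exact h4.symm

end OddPerturbation

/-! ### Odd changes of the variables β. -/

theorem SmoothNear.exists_local_inverse_of_injective {E : Type*} [NormedAddCommGroup E]
    [NormedSpace ℝ E] [FiniteDimensional ℝ E] {r : WithTop ℕ∞} (hr : r = ∞ ∨ r = ω) {f : E → E}
    (hf : SmoothNear r f 0) (h0 : f 0 = 0) (hinj : ∀ v, fderiv ℝ f 0 v = 0 → v = 0) :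
    ∃ g : E → E, g 0 = 0 ∧ SmoothNear r g 0 ∧
      (∀ᶠ x in 𝓝 (0 : E), g (f x) = x) ∧ (∀ᶠ y in 𝓝 (0 : E), f (g y) = y) := by
  have : CompleteSpace E := FiniteDimensional.complete ℝ E
  have hinj' : Function.Injective (fderiv ℝ f 0 : E →ₗ[ℝ] E) :=
    (injective_iff_map_eq_zero _).2 hinj
  refine hf.exists_local_inverse hr h0
    (LinearEquiv.ofInjectiveEndo _ hinj').toContinuousLinearEquiv ?_
  convert! (hf.differentiableAt hr).hasFDerivAt using 1

section OddChanges

variable {n m : ℕ} {r : WithTop ℕ∞}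

/-- A `C^r` change of the variables `β` depending on `λ` and odd in `β`, as a germ. -/
structure IsOddChange (r : WithTop ℕ∞) (Φ : BigSpace n m → (Fin n → ℝ)) : Prop where
  smooth : SmoothNear r Φ 0
  odd : ∀ᶠ p in 𝓝 (0 : BigSpace n m), Φ (-p.1, p.2) = -Φ p
  injective : ∀ b, fderiv ℝ Φ 0 (b, 0) = 0 → b = 0

namespace IsOddChange

variable {Φ Φ' : BigSpace n m → (Fin n → ℝ)}

theorem eventually_apply_zero (h : IsOddChange r Φ) :
    ∀ᶠ l in 𝓝 (0 : Fin m → ℝ), Φ (0, l) = 0 := by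
  have ht : Tendsto (fun l : Fin m → ℝ => ((0, l) : BigSpace n m)) (𝓝 0) (𝓝 0) :=
    (Continuous.prodMk_right (0 : Fin n → ℝ)).tendsto' _ _ rfl
  filter_upwards [ht.eventually h.odd] with l hl
  rw [neg_zero] at hl
  exact self_eq_neg.1 hl

theorem apply_zero (h : IsOddChange r Φ) : Φ 0 = 0 := h.eventually_apply_zero.self_of_nhds

theorem smooth_prod (h : IsOddChange r Φ) :
    SmoothNear r (fun p => ((Φ p, p.2) : BigSpace n m)) 0 :=
  h.smooth.prodMk (SmoothNear.of_contDiff contDiff_snd)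

theorem prod_zero (h : IsOddChange r Φ) :
    ((Φ 0, (0 : BigSpace n m).2) : BigSpace n m) = 0 := by rw [h.apply_zero]; rfl

theorem tendsto_prod (h : IsOddChange r Φ) :
    Tendsto (fun p => ((Φ p, p.2) : BigSpace n m)) (𝓝 0) (𝓝 0) :=
  h.smooth_prod.tendsto h.prod_zero

theorem hasFDerivAt_prod (h : IsOddChange r Φ) (hr : r = ∞ ∨ r = ω) :
    HasFDerivAt (fun p => ((Φ p, p.2) : BigSpace n m))
      ((fderiv ℝ Φ 0).prod (ContinuousLinearMap.snd ℝ _ _)) 0 :=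
  (h.smooth.differentiableAt hr).hasFDerivAt.prodMk hasFDerivAt_snd

theorem comp (h : IsOddChange r Φ) (h' : IsOddChange r Φ') (hr : r = ∞ ∨ r = ω) :
    IsOddChange r (fun p => Φ' (Φ p, p.2)) := by
  refine ⟨h'.smooth.comp h.smooth_prod h.prod_zero, ?_, fun b hb => ?_⟩
  · filter_upwards [h.odd, h.tendsto_prod.eventually h'.odd] with p h1 h2
    rw [h1, h2]
  · have h1 : HasFDerivAt Φ' (fderiv ℝ Φ' 0) ((Φ 0, (0 : BigSpace n m).2) : BigSpace n m) := by
      rw [h.prod_zero]; exact (h'.smooth.differentiableAt hr).hasFDerivAt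
    have h2 := (HasFDerivAt.comp (0 : BigSpace n m) h1 (h.hasFDerivAt_prod hr)).fderiv
    have h3 : fderiv ℝ Φ' 0 (fderiv ℝ Φ 0 (b, 0), 0) = 0 := by
      rw [← hb]
      exact (DFunLike.congr_fun h2 _).symm
    exact h.injective b (h'.injective _ h3)

theorem exists_inverse (h : IsOddChange r Φ) (hr : r = ∞ ∨ r = ω) :
    ∃ Φ' : BigSpace n m → (Fin n → ℝ), IsOddChange r Φ' ∧
      (∀ᶠ p in 𝓝 (0 : BigSpace n m), Φ' (Φ p, p.2) = p.1) ∧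
      (∀ᶠ p in 𝓝 (0 : BigSpace n m), Φ (Φ' p, p.2) = p.1) := by
  have hder := h.hasFDerivAt_prod hr
  obtain ⟨g, hg0, hg, hl, hri⟩ := h.smooth_prod.exists_local_inverse_of_injective hr h.prod_zero
    (by
      rintro ⟨b, l⟩ hv
      rw [hder.fderiv] at hv
      have h2 : l = 0 := congrArg Prod.snd hv
      subst h2
      rw [h.injective b (congrArg Prod.fst hv)]
      rfl)
  have hg' : ∀ᶠ p in 𝓝 (0 : BigSpace n m), g p = ((g p).1, p.2) := by
    filter_upwards [hri] with p hp
    exact Prod.ext rfl (congrArg (fun q : BigSpace n m => q.2) hp :)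
  have hri' : ∀ᶠ p in 𝓝 (0 : BigSpace n m), Φ ((g p).1, p.2) = p.1 := by
    filter_upwards [hri, hg'] with p hp hp'
    rw [← hp']
    exact congrArg Prod.fst hp
  have hgs : SmoothNear r (fun p => (g p).1) 0 := hg.continuousLinearMap_comp
    (ContinuousLinearMap.fst ℝ _ _)
  have hgs2 : SmoothNear r (fun p : BigSpace n m => (((g p).1, p.2) : BigSpace n m)) 0 :=
    hgs.prodMk (SmoothNear.of_contDiff contDiff_snd)
  have hg00 : (((g 0).1, (0 : BigSpace n m).2) : BigSpace n m) = 0 := by rw [hg0]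
  refine ⟨fun p => (g p).1, ⟨hgs, ?_, fun b hb => ?_⟩, ?_, hri'⟩
  · filter_upwards [hri, hg', (hg.tendsto hg0).eventually h.odd,
      (tendsto_reflectVar.comp (hg.tendsto hg0)).eventually hl] with p h1 h2 h3 h4
    simp only [Function.comp_apply, reflectVar_apply, h3] at h4
    have h5 : Φ (g p) = p.1 := congrArg Prod.fst h1
    have h6 : (g p).2 = p.2 := (congrArg (fun q : BigSpace n m => q.2) h1 :)
    rw [h5, h6] at h4
    exact congrArg Prod.fst h4
  · have h1 : HasFDerivAt Φ (fderiv ℝ Φ 0) (((g 0).1, (0 : BigSpace n m).2) : BigSpace n m) := by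
      rw [hg00]; exact (h.smooth.differentiableAt hr).hasFDerivAt
    have h2 : HasFDerivAt (fun p : BigSpace n m => (((g p).1, p.2) : BigSpace n m))
        ((fderiv ℝ (fun p => (g p).1) 0).prod (ContinuousLinearMap.snd ℝ _ _)) 0 :=
      (hgs.differentiableAt hr).hasFDerivAt.prodMk hasFDerivAt_snd
    have h3 := (HasFDerivAt.comp (0 : BigSpace n m) h1 h2).congr_of_eventuallyEq
      (hri'.mono fun p hp => hp.symm)
    have h4 := DFunLike.congr_fun (h3.unique hasFDerivAt_fst) (b, 0)
    simp only [ContinuousLinearMap.comp_apply, ContinuousLinearMap.prod_apply, hb] at h4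
    have h5 : ((0, ContinuousLinearMap.snd ℝ (Fin n → ℝ) (Fin m → ℝ) (b, 0)) : BigSpace n m) = 0 :=
      rfl
    rw [h5, map_zero] at h4
    exact h4.symm
  · filter_upwards [hl] with p hp
    rw [hp]

end IsOddChange

end OddChanges

/-- A function vanishing on the zero set of a submersion has a differential vanishing on the
tangent space of this set. -/
theorem fderiv_eq_zero_of_vanishing {E Y Z : Type*} [NormedAddCommGroup E] [NormedSpace ℝ E]
    [CompleteSpace E] [NormedAddCommGroup Y] [NormedSpace ℝ Y] [FiniteDimensional ℝ Y]
    [NormedAddCommGroup Z] [NormedSpace ℝ Z] {r : WithTop ℕ∞} (hr : r = ∞ ∨ r = ω)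
    {g : E → Y} (hg : SmoothNear r g 0) (hg0 : g 0 = 0)
    (hsurj : Function.Surjective (fderiv ℝ g 0)) {h : E → Z} (hh : DifferentiableAt ℝ h 0)
    (hvan : ∀ᶠ p in 𝓝 (0 : E), g p = 0 → h p = 0) {v : E} (hv : fderiv ℝ g 0 v = 0) :
    fderiv ℝ h 0 v = 0 := by
  have : CompleteSpace Y := FiniteDimensional.complete ℝ Y
  have hst : HasStrictFDerivAt g (fderiv ℝ g 0) 0 :=
    hg.contDiffAt.hasStrictFDerivAt (ne_zero_of_infty_or_omega hr)
  have hrange : (fderiv ℝ g 0).range = ⊤ := LinearMap.range_eq_top.2 hsurj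
  -- A parametrisation of the zero set of g by ker dg, tangent to the inclusion at 0; h ∘ γ
  -- vanishes, hence so does dh on ker dg.
  let γ := hst.implicitFunction g (fderiv ℝ g 0) hrange (g 0)
  have hγ : HasStrictFDerivAt γ (fderiv ℝ g 0).ker.subtypeL 0 := hst.to_implicitFunction hrange
  have hγ0 : γ 0 = 0 := by
    simp [γ]
  have hgγ : ∀ᶠ z in 𝓝 (0 : (fderiv ℝ g 0).ker), g (γ z) = 0 := by
    have h1 := hst.map_implicitFunction_eq hrange
    have h2 : Tendsto (fun z : (fderiv ℝ g 0).ker => (g 0, z)) (𝓝 0) (𝓝 (g 0, 0)) :=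
      (Continuous.prodMk_right (g 0)).tendsto' _ _ rfl
    filter_upwards [h2.eventually h1] with z hz
    exact hz.trans hg0
  have hγt : Tendsto γ (𝓝 0) (𝓝 0) := by
    have := hγ.hasFDerivAt.continuousAt
    rwa [ContinuousAt, hγ0] at this
  have h1 : (fun z => h (γ z)) =ᶠ[𝓝 0] fun _ => 0 := by
    filter_upwards [hgγ, hγt.eventually hvan] with z hz1 hz2 using hz2 hz1
  have h2 : HasFDerivAt (fun z => h (γ z))
      ((fderiv ℝ h 0).comp (fderiv ℝ g 0).ker.subtypeL) 0 := by
    refine HasFDerivAt.comp (g := h) 0 ?_ hγ.hasFDerivAt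
    rw [hγ0]
    exact hh.hasFDerivAt
  have h3 := h2.unique ((hasFDerivAt_const (0 : Z) _).congr_of_eventuallyEq h1)
  exact DFunLike.congr_fun h3 (⟨v, hv⟩ : (fderiv ℝ g 0).ker)

/-! ### Uniqueness of the odd family generating a given germ. -/

section Uniqueness

variable {n n' m : ℕ} {r : WithTop ℕ∞}

/-- Near the origin, every point determined by the critical points of `G` is determined by
critical points of `F` arbitrarily close to the origin. -/
def CriticallyCovers (F : BigSpace n m → ℝ) (G : BigSpace n' m → ℝ) : Prop :=
  ∀ U ∈ 𝓝 (0 : BigSpace n m), ∀ᶠ p in 𝓝 (0 : BigSpace n' m), gradVar G p = 0 →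
    ∃ β, (β, p.2) ∈ U ∧ gradVar F (β, p.2) = 0 ∧ gradPar F (β, p.2) = gradPar G p

/-- Momenta are read off the Lagrangian germ itself, so their projection by P gives fibre variables
that can be compared between different families. -/
theorem IsOddFamily.isOddChange {F : BigSpace n m → ℝ} (hF : IsOddFamily r F)
    (hr : r = ∞ ∨ r = ω) (P : (Fin m → ℝ) →L[ℝ] (Fin n → ℝ))
    (hP : ∀ b, P (fderiv ℝ (gradPar F) 0 (b, 0)) = 0 → b = 0) :
    IsOddChange r (fun p => P (gradPar F p)) := by
  refine ⟨(hF.smooth.gradPar hr).continuousLinearMap_comp P, ?_, fun b hb => hP b ?_⟩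
  · filter_upwards [hF.gradPar_odd hr] with p hp
    rw [hp, map_neg]
  · have := (P.hasFDerivAt.comp (0 : BigSpace n m)
      ((hF.smooth.gradPar hr).differentiableAt hr).hasFDerivAt).fderiv
    rw [← hb]
    exact (DFunLike.congr_fun this _).symm

/-- Inverting the change P(∂F/∂λ) expresses κ as a function k of (P κ, λ) at the critical points of
F, hence, by covering, also at those of G. Differentiating this relation along the tangent direction
(b, 0) shows that P kills no nonzero vector d(∂G/∂λ)(b, 0). -/
theorem IsOddFamily.injective_of_covers {F : BigSpace n m → ℝ} (hF : IsOddFamily r F)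
    {G : BigSpace n' m → ℝ} (hG : IsOddFamily r G) (hr : r = ∞ ∨ r = ω)
    (hFG : CriticallyCovers F G) (P : (Fin m → ℝ) →L[ℝ] (Fin n → ℝ))
    (hP : ∀ b, P (fderiv ℝ (gradPar F) 0 (b, 0)) = 0 → b = 0) {b : Fin n' → ℝ}
    (hb : P (fderiv ℝ (gradPar G) 0 (b, 0)) = 0) : b = 0 := by
  obtain ⟨J, hJ, hJl, -⟩ := (hF.isOddChange hr P hP).exists_inverse hr
  have hGp := hG.smooth.gradPar hr
  have hFp := hF.smooth.gradPar hr
  let c : BigSpace n' m → BigSpace n m := fun p => (P (gradPar G p), p.2)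
  have hc : SmoothNear r c 0 :=
    (hGp.continuousLinearMap_comp P).prodMk (SmoothNear.of_contDiff contDiff_snd)
  have hc0 : c 0 = 0 := by simp [c, hG.gradPar_zero hr]
  let k : BigSpace n m → (Fin m → ℝ) := fun y => gradPar F (J y, y.2)
  have hk : SmoothNear r k 0 := hFp.comp hJ.smooth_prod hJ.prod_zero
  have hvan : ∀ᶠ p in 𝓝 (0 : BigSpace n' m), gradVar G p = 0 → gradPar G p - k (c p) = 0 := by
    filter_upwards [hFG _ hJl] with p hp hp0
    obtain ⟨β, h1, -, h3⟩ := hp hp0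
    simp only [h3] at h1
    simp only [k, c, h1, h3, sub_self]
  have hc' : HasFDerivAt c ((P.comp (fderiv ℝ (gradPar G) 0)).prod
      (ContinuousLinearMap.snd ℝ _ _)) 0 :=
    (P.hasFDerivAt.comp (0 : BigSpace n' m) (hGp.differentiableAt hr).hasFDerivAt).prodMk
      hasFDerivAt_snd
  have hkc' : HasFDerivAt (fun p => k (c p)) ((fderiv ℝ k 0).comp
      ((P.comp (fderiv ℝ (gradPar G) 0)).prod (ContinuousLinearMap.snd ℝ _ _))) 0 := by
    refine HasFDerivAt.comp (g := k) (0 : BigSpace n' m) ?_ hc'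
    rw [hc0]
    exact (hk.differentiableAt hr).hasFDerivAt
  have hd := (hGp.differentiableAt hr).hasFDerivAt.sub hkc'
  have h0 := fderiv_eq_zero_of_vanishing hr (hG.smooth.gradVar hr) hG.critical hG.surjective
    hd.differentiableAt hvan (hG.fderiv_gradVar_inl hr b)
  rw [hd.fderiv] at h0
  refine hG.gradPar_injective hr ?_
  have h1 : ((P.comp (fderiv ℝ (gradPar G) 0)).prod
      (ContinuousLinearMap.snd ℝ (Fin n' → ℝ) (Fin m → ℝ))) (b, 0) = 0 := Prod.ext hb rfl
  rwa [sub_apply, ContinuousLinearMap.comp_apply, h1, map_zero, sub_zero] at h0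

theorem IsOddFamily.exists_leftInverse {F : BigSpace n m → ℝ} (hF : IsOddFamily r F)
    (hr : r = ∞ ∨ r = ω) : ∃ P : (Fin m → ℝ) →L[ℝ] (Fin n → ℝ),
      ∀ b, P (fderiv ℝ (gradPar F) 0 (b, 0)) = 0 → b = 0 := by
  let C : (Fin n → ℝ) →ₗ[ℝ] (Fin m → ℝ) :=
    ((fderiv ℝ (gradPar F) 0).comp (ContinuousLinearMap.inl ℝ _ _) : _ →L[ℝ] _)
  obtain ⟨P, hP⟩ := C.exists_leftInverse_of_injective
    (LinearMap.ker_eq_bot'.2 fun b hb => hF.gradPar_injective hr hb)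
  refine ⟨LinearMap.toContinuousLinearMap P, fun b hb => ?_⟩
  have h1 : P (C b) = b := LinearMap.congr_fun hP b
  rw [← h1]
  exact hb

theorem IsOddFamily.card_le_of_covers {F : BigSpace n m → ℝ} (hF : IsOddFamily r F)
    {G : BigSpace n' m → ℝ} (hG : IsOddFamily r G) (hr : r = ∞ ∨ r = ω)
    (hFG : CriticallyCovers F G) : n' ≤ n := by
  obtain ⟨P, hP⟩ := hF.exists_leftInverse hr
  let C : (Fin n' → ℝ) →ₗ[ℝ] (Fin n → ℝ) :=
    (P.comp ((fderiv ℝ (gradPar G) 0).comp (ContinuousLinearMap.inl ℝ _ _)) : _ →L[ℝ] _)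
  have := LinearMap.finrank_le_finrank_of_injective (f := C)
    ((injective_iff_map_eq_zero _).2 fun b hb => hF.injective_of_covers hG hr hFG P hP hb)
  simpa using this

theorem fderiv_apply_eq (F : BigSpace n m → ℝ) (p w : BigSpace n m) :
    fderiv ℝ F p w = dotProduct (gradVar F p) w.1 + dotProduct (gradPar F p) w.2 := by
  rw [gradVar_eq, gradPar_eq, varPart_dotProduct, parPart_dotProduct, ← map_add]
  simp

/-- Two odd families that agree to first order on the critical set of the first one differ by an
odd change of `β`. -/
theorem IsOddFamily.exists_change_of_agree {F D : BigSpace n m → ℝ} (hF : IsOddFamily r F)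
    (hr : r = ∞ ∨ r = ω) (hD : SmoothNear r D 0)
    (hDodd : ∀ᶠ p in 𝓝 (0 : BigSpace n m), D (-p.1, p.2) = -D p)
    (hcrit : ∀ᶠ p in 𝓝 (0 : BigSpace n m), gradVar F p = 0 → fderiv ℝ D p = 0) :
    ∃ Θ : BigSpace n m → (Fin n → ℝ), IsOddChange r Θ ∧
      ∀ᶠ p in 𝓝 (0 : BigSpace n m), F (Θ p, p.2) = F p + D p := by
  have hv := hF.smooth.gradVar hr
  obtain ⟨S, hS⟩ := LinearMap.exists_rightInverse_of_surjective
    (fderiv ℝ (gradVar F) 0 : BigSpace n m →ₗ[ℝ] (Fin n → ℝ))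
    (LinearMap.range_eq_top.2 hF.surjective)
  have hD0 : D 0 = 0 := by
    have h := hDodd.self_of_nhds
    have h0 : ((-(0 : BigSpace n m).1, (0 : BigSpace n m).2) : BigSpace n m) = 0 := by simp
    rw [h0] at h
    linarith
  obtain ⟨A, hA, hDA⟩ := hv.exists_quadratic_division hr hF.critical
    (LinearMap.toContinuousLinearMap S) (fun y => LinearMap.congr_fun hS y) hD hD0 hcrit
  -- D is odd and v is even, so the odd part of A represents D equally well.
  let A' : BigSpace n m → (Fin n → ℝ) →L[ℝ] (Fin n → ℝ) →L[ℝ] ℝ := fun p =>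
    (1 / 2 : ℝ) • (A p - A (reflectVar n m p))
  have hA' : SmoothNear r A' 0 := by
    have h1 : SmoothNear r (fun p => A p - A (reflectVar n m p)) 0 :=
      hA.sub (hA.comp (SmoothNear.of_contDiff (reflectVar n m).contDiff) (map_zero _))
    filter_upwards [h1] with p hp using hp.const_smul _
  have hA'odd : ∀ p, A' (-p.1, p.2) = -A' p := fun p => by
    simp only [A', reflectVar_apply, neg_neg, Prod.mk.eta]
    exact (congrArg (fun B => (1 / 2 : ℝ) • B) (neg_sub (A p) (A (-p.1, p.2))).symm).trans
      (smul_neg _ _)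
  obtain ⟨s, hs, hs0, hsodd, hFs⟩ := hF.exists_reparametrisation hr hA' hA'odd
  have hsv : SmoothNear r (fun p => s p (gradVar F p)) 0 := hs.clm_apply hv
  refine ⟨fun p => p.1 + s p (gradVar F p), ⟨?_, ?_, fun b hb => ?_⟩, ?_⟩
  · exact (SmoothNear.of_contDiff contDiff_fst).add hsv
  · filter_upwards [hsodd, hF.gradVar_even hr] with p h1 h2
    rw [h1, h2, neg_apply, neg_add]
  -- Both s and v vanish at the origin, so β + s v has the derivative of β there.
  · have h1 : HasFDerivAt (fun p => s p (gradVar F p)) (0 : BigSpace n m →L[ℝ] (Fin n → ℝ)) 0 := by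
      have := (hs.differentiableAt hr).hasFDerivAt.clm_apply (hv.differentiableAt hr).hasFDerivAt
      rw [hs0, hF.critical] at this
      simpa using this
    have h2 := ((hasFDerivAt_fst (𝕜 := ℝ) (p := (0 : BigSpace n m))).add h1).fderiv
    rw [add_zero] at h2
    rw [← hb]
    exact (DFunLike.congr_fun h2 (b, (0 : Fin m → ℝ))).symm
  · filter_upwards [hFs, hDA, tendsto_reflectVar.eventually hDA, hDodd, hF.gradVar_even hr]
      with p h1 h2 h3 h4 h5
    rw [h1]
    rw [reflectVar_apply, h4, h5] at h3
    simp only [A', smul_apply, sub_apply, reflectVar_apply, smul_eq_mul]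
    linarith

/-- Odd families determining the same Lagrangian germ differ by an odd change of `β`. -/
theorem IsOddFamily.exists_change {F G : BigSpace n m → ℝ} (hF : IsOddFamily r F)
    (hG : IsOddFamily r G) (hr : r = ∞ ∨ r = ω) (hFG : CriticallyCovers F G)
    (hGF : CriticallyCovers G F) :
    ∃ Φ : BigSpace n m → (Fin n → ℝ), IsOddChange r Φ ∧
      ∀ᶠ p in 𝓝 (0 : BigSpace n m), F p = G (Φ p, p.2) := by
  obtain ⟨P, hP⟩ := hF.exists_leftInverse hr
  have hPF := hF.isOddChange hr P hP
  have hPG := hG.isOddChange hr P fun b hb => hF.injective_of_covers hG hr hFG P hP hb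
  obtain ⟨J, hJ, hJl, -⟩ := hPG.exists_inverse hr
  have hΦ := hPF.comp hJ hr
  -- Φ sends β to the variable at which G has the same projected momentum over λ. At a critical
  -- point of F this is the critical point of G with the same full momentum, so the differentials of
  -- F and G ∘ Φ agree there.
  set Φ : BigSpace n m → (Fin n → ℝ) := fun p => J (P (gradPar F p), p.2) with hΦdef
  have hGΦ : SmoothNear r (fun p => G (Φ p, p.2)) 0 := hG.smooth.comp hΦ.smooth_prod hΦ.prod_zero
  obtain ⟨Θ, hΘ, hFΘ⟩ := hF.exists_change_of_agree hr (D := fun p => G (Φ p, p.2) - F p)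
    (hGΦ.sub hF.smooth)
    (by
      filter_upwards [hF.odd, hΦ.odd, hΦ.tendsto_prod.eventually hG.odd] with p h1 h2 h3
      rw [h1, h2, h3]
      ring)
    (by
      filter_upwards [hGF _ hJl, hF.smooth.eventually_differentiableAt hr,
        hΦ.smooth.eventually_differentiableAt hr,
        hΦ.tendsto_prod.eventually (hG.smooth.eventually_differentiableAt hr)] with p h1 h2 h3 h4 h0
      obtain ⟨β, h5, h6, h7⟩ := h1 h0
      simp only [h7] at h5
      have h8 : Φ p = β := h5
      have h9 : HasFDerivAt (fun q : BigSpace n m => ((Φ q, q.2) : BigSpace n m))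
          ((fderiv ℝ Φ p).prod (ContinuousLinearMap.snd ℝ _ _)) p :=
        h3.hasFDerivAt.prodMk hasFDerivAt_snd
      have h10 := ((HasFDerivAt.comp p h4.hasFDerivAt h9).sub h2.hasFDerivAt).fderiv
      refine h10.trans ?_
      refine ContinuousLinearMap.ext fun w => ?_
      rw [sub_apply, ContinuousLinearMap.comp_apply, fderiv_apply_eq G, fderiv_apply_eq F, h8,
        h6, h7, h0, zero_dotProduct, zero_dotProduct]
      simp)
  obtain ⟨Θ', hΘ', -, hΘr⟩ := hΘ.exists_inverse hr
  -- Since F ∘ Θ = F + D = G ∘ Φ over each λ, inverting Θ gives the change sought.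
  refine ⟨fun p => Φ (Θ' p, p.2), hΘ'.comp hΦ hr, ?_⟩
  filter_upwards [hΘr, hΘ'.tendsto_prod.eventually hFΘ] with p h1 h2
  simp only [h1, Prod.mk.eta] at h2
  rw [h2]
  ring

end Uniqueness

/-! ### Cotangent lifts and odd fibred symplectomorphisms. -/

theorem SmoothNear.fderiv_fderiv_of_inverse {E E' : Type*} [NormedAddCommGroup E] [NormedSpace ℝ E]
    [NormedAddCommGroup E'] [NormedSpace ℝ E'] {r : WithTop ℕ∞} (hr : r = ∞ ∨ r = ω)
    {f : E → E'} {g : E' → E} (hf : SmoothNear r f 0) (hf0 : f 0 = 0) (hg : SmoothNear r g 0)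
    (h : ∀ᶠ x in 𝓝 (0 : E), g (f x) = x) :
    ∀ᶠ x in 𝓝 (0 : E), ∀ v, fderiv ℝ g (f x) (fderiv ℝ f x v) = v := by
  filter_upwards [h.eventually_nhds, hf.eventually_differentiableAt hr,
    (hf.tendsto hf0).eventually (hg.eventually_differentiableAt hr)] with x h1 h2 h3 v
  have h4 := (h3.hasFDerivAt.comp x h2.hasFDerivAt).congr_of_eventuallyEq
    (h1.mono fun y hy => hy.symm)
  exact DFunLike.congr_fun (h4.unique (hasFDerivAt_id x)) v

section CotangentLift

variable {m : ℕ} {r : WithTop ℕ∞}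

/-- `Λ` and `N` are mutually inverse diffeomorphism-germs of class `C^r`. -/
structure InverseGerms (r : WithTop ℕ∞) (Λ N : (Fin m → ℝ) → (Fin m → ℝ)) : Prop where
  smooth : SmoothNear r Λ 0
  smooth_inv : SmoothNear r N 0
  apply_zero : Λ 0 = 0
  inv_zero : N 0 = 0
  left : ∀ᶠ l in 𝓝 (0 : Fin m → ℝ), N (Λ l) = l
  right : ∀ᶠ l in 𝓝 (0 : Fin m → ℝ), Λ (N l) = l

theorem SmoothNear.exists_inverseGerms (hr : r = ∞ ∨ r = ω) {Λ : (Fin m → ℝ) → (Fin m → ℝ)}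
    (hΛ : SmoothNear r Λ 0) (h0 : Λ 0 = 0) (hsurj : ∀ y, ∃ v, fderiv ℝ Λ 0 v = y) :
    ∃ N, InverseGerms r Λ N := by
  have hinj : Function.Injective (fderiv ℝ Λ 0 : (Fin m → ℝ) →ₗ[ℝ] (Fin m → ℝ)) :=
    LinearMap.injective_iff_surjective.2 hsurj
  obtain ⟨N, hN0, hN, hl, hri⟩ := hΛ.exists_local_inverse_of_injective hr h0
    ((injective_iff_map_eq_zero _).1 hinj)
  exact ⟨N, hΛ, hN, h0, hN0, hl, hri⟩

namespace InverseGerms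

variable {Λ N : (Fin m → ℝ) → (Fin m → ℝ)}

theorem symm (h : InverseGerms r Λ N) : InverseGerms r N Λ :=
  ⟨h.smooth_inv, h.smooth, h.inv_zero, h.apply_zero, h.right, h.left⟩

theorem tendsto (h : InverseGerms r Λ N) : Tendsto Λ (𝓝 0) (𝓝 0) := h.smooth.tendsto h.apply_zero

theorem fderiv_left (h : InverseGerms r Λ N) (hr : r = ∞ ∨ r = ω) :
    ∀ᶠ l in 𝓝 (0 : Fin m → ℝ), ∀ v, fderiv ℝ N (Λ l) (fderiv ℝ Λ l v) = v :=
  h.smooth.fderiv_fderiv_of_inverse hr h.apply_zero h.smooth_inv h.left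

theorem fderiv_right (h : InverseGerms r Λ N) (hr : r = ∞ ∨ r = ω) :
    ∀ᶠ l in 𝓝 (0 : Fin m → ℝ), ∀ v, fderiv ℝ Λ l (fderiv ℝ N (Λ l) v) = v := by
  filter_upwards [h.left, h.tendsto.eventually (h.symm.fderiv_left hr)] with l h1 h2 v
  have := h2 v
  rwa [h1] at this

end InverseGerms

/-- The dot product as a continuous bilinear form. -/
noncomputable def dotL (k : ℕ) : (Fin k → ℝ) →L[ℝ] (Fin k → ℝ) →L[ℝ] ℝ :=
  ∑ i, (ContinuousLinearMap.proj (R := ℝ) (φ := fun _ : Fin k => ℝ) i).smulRight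
    (ContinuousLinearMap.proj (R := ℝ) (φ := fun _ : Fin k => ℝ) i)

@[simp] theorem dotL_apply {k : ℕ} (v w : Fin k → ℝ) : dotL k v w = dotProduct v w := by
  simp [dotL, dotProduct]

theorem canonicalForm_eq (v w : PhaseSpace m) :
    canonicalForm v w = dotProduct v.1 w.2 - dotProduct w.1 v.2 := by
  simp [canonicalForm, dotProduct, Finset.sum_sub_distrib]

theorem tendsto_snd_zero {V W : Type*} [NormedAddCommGroup V] [NormedAddCommGroup W] :
    Tendsto (fun x : V × W => x.2) (𝓝 0) (𝓝 0) := continuous_snd.tendsto' _ _ rfl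

theorem SmoothNear.comp_snd {V W Z : Type*} [NormedAddCommGroup V] [NormedSpace ℝ V]
    [NormedAddCommGroup W] [NormedSpace ℝ W] [NormedAddCommGroup Z] [NormedSpace ℝ Z]
    {f : W → Z} (hf : SmoothNear r f 0) : SmoothNear r (fun x : V × W => f x.2) 0 :=
  hf.comp (SmoothNear.of_contDiff contDiff_snd) rfl

/-- The cotangent lift of `Λ`, whose inverse germ is `N`. -/
noncomputable def cotangentLift (Λ N : (Fin m → ℝ) → (Fin m → ℝ)) (x : PhaseSpace m) :
    PhaseSpace m :=
  (fun i => dotProduct x.1 (fderiv ℝ N (Λ x.2) (Pi.single i 1)), Λ x.2)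

theorem cotangentLift_dotProduct (Λ N : (Fin m → ℝ) → (Fin m → ℝ)) (x : PhaseSpace m)
    (v : Fin m → ℝ) :
    dotProduct (cotangentLift Λ N x).1 v = dotProduct x.1 (fderiv ℝ N (Λ x.2) v) := by
  have := dotProduct_eq_of_linear ((dotL m x.1).comp (fderiv ℝ N (Λ x.2))) v
  simpa [cotangentLift] using this

theorem InverseGerms.smooth_cotangentLift {Λ N : (Fin m → ℝ) → (Fin m → ℝ)}
    (h : InverseGerms r Λ N) (hr : r = ∞ ∨ r = ω) : SmoothNear r (cotangentLift Λ N) 0 := by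
  refine SmoothNear.prodMk (SmoothNear.pi fun i => ?_) h.smooth.comp_snd
  have h1 : SmoothNear r (fun x : PhaseSpace m => fderiv ℝ N (Λ x.2)) 0 :=
    (h.smooth_inv.fderiv_right hr).comp h.smooth.comp_snd h.apply_zero
  have h2 : SmoothNear r (fun x : PhaseSpace m => dotL m x.1) 0 :=
    SmoothNear.of_contDiff (by fun_prop)
  have h3 := h2.clm_apply (h1.clm_apply
    (SmoothNear.of_contDiff (contDiff_const (c := (Pi.single i 1 : Fin m → ℝ)))))
  simpa using h3

theorem InverseGerms.cotangentLift_left {Λ N : (Fin m → ℝ) → (Fin m → ℝ)}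
    (h : InverseGerms r Λ N) (hr : r = ∞ ∨ r = ω) :
    ∀ᶠ x in 𝓝 (0 : PhaseSpace m), cotangentLift N Λ (cotangentLift Λ N x) = x := by
  filter_upwards [tendsto_snd_zero.eventually h.left,
    tendsto_snd_zero.eventually (h.fderiv_left hr)] with x h1 h2
  refine Prod.ext (eq_of_dotProduct_eq fun v => ?_) h1
  rw [cotangentLift_dotProduct, cotangentLift_dotProduct]
  have h3 : (cotangentLift Λ N x).2 = Λ x.2 := rfl
  rw [h3, h1, h2]

theorem cotangentLift_zero {Λ N : (Fin m → ℝ) → (Fin m → ℝ)} (h : Λ 0 = 0) :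
    cotangentLift Λ N 0 = 0 := by
  refine Prod.ext (eq_of_dotProduct_eq fun v => ?_) h
  rw [cotangentLift_dotProduct]
  simp

/-- A fibred germ that preserves the tautological one-form is symplectic. -/
theorem symplectic_of_preserves_tautological (hr : r = ∞ ∨ r = ω)
    {A : PhaseSpace m → (Fin m → ℝ)} {Λ : (Fin m → ℝ) → (Fin m → ℝ)}
    (hA : SmoothNear r A 0) (hΛ : SmoothNear r Λ 0)
    (h : ∀ᶠ x in 𝓝 (0 : PhaseSpace m), ∀ u,
      dotProduct (A x) (fderiv ℝ Λ x.2 u) = dotProduct x.1 u) :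
    ∀ᶠ x in 𝓝 (0 : PhaseSpace m), ∀ v w,
      canonicalForm (fderiv ℝ (fun x => ((A x, Λ x.2) : PhaseSpace m)) x v)
        (fderiv ℝ (fun x => ((A x, Λ x.2) : PhaseSpace m)) x w) = canonicalForm v w := by
  have hsymm : ∀ᶠ l in 𝓝 (0 : Fin m → ℝ), IsSymmSndFDerivAt ℝ Λ l := by
    filter_upwards [hΛ] with l hl
    refine hl.isSymmSndFDerivAt ?_
    rw [minSmoothness_of_isRCLikeNormedField]
    rcases hr with rfl | rfl
    · exact WithTop.coe_le_coe.2 (le_top : (2 : ℕ∞) ≤ ⊤)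
    · exact le_top
  filter_upwards [h.eventually_nhds, hA.eventually_differentiableAt hr,
    tendsto_snd_zero.eventually (hΛ.eventually_differentiableAt hr),
    tendsto_snd_zero.eventually ((hΛ.fderiv_right hr).eventually_differentiableAt hr),
    tendsto_snd_zero.eventually hsymm] with x h1 h2 h3 h4 h5 v w
  have hT : HasFDerivAt (fun x => ((A x, Λ x.2) : PhaseSpace m))
      ((fderiv ℝ A x).prod ((fderiv ℝ Λ x.2).comp (ContinuousLinearMap.snd ℝ _ _))) x :=
    h2.hasFDerivAt.prodMk (HasFDerivAt.comp (g := Λ) x h3.hasFDerivAt hasFDerivAt_snd)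
  -- The tautological identity A · dΛ u = κ · u, differentiated along v. Antisymmetrising in v and w
  -- cancels the terms with the second derivative of Λ.
  have key : ∀ v : PhaseSpace m, ∀ u, dotProduct (fderiv ℝ A x v) (fderiv ℝ Λ x.2 u) +
      dotProduct (A x) (fderiv ℝ (fderiv ℝ Λ) x.2 v.2 u) = dotProduct v.1 u := by
    intro v u
    have e1 : HasFDerivAt (fun x => dotL m (A x)) ((dotL m).comp (fderiv ℝ A x)) x :=
      (dotL m).hasFDerivAt.comp x h2.hasFDerivAt
    have e2 : HasFDerivAt (fun x : PhaseSpace m => fderiv ℝ Λ x.2)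
        ((fderiv ℝ (fderiv ℝ Λ) x.2).comp (ContinuousLinearMap.snd ℝ _ _)) x :=
      HasFDerivAt.comp (g := fderiv ℝ Λ) x h4.hasFDerivAt hasFDerivAt_snd
    have e3 := e1.clm_apply (e2.clm_apply (hasFDerivAt_const u x))
    have e4 : HasFDerivAt (fun x : PhaseSpace m => dotL m x.1 u)
        (((dotL m).flip u).comp (ContinuousLinearMap.fst ℝ _ _)) x :=
      HasFDerivAt.comp x ((dotL m).flip u).hasFDerivAt hasFDerivAt_fst
    have e5 := e3.unique (e4.congr_of_eventuallyEq (by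
      filter_upwards [h1] with y hy
      simpa using hy u))
    have e6 := DFunLike.congr_fun e5 v
    simp only [add_apply, ContinuousLinearMap.comp_apply,
      ContinuousLinearMap.flip_apply, dotL_apply] at e6
    simp at e6
    linarith
  rw [hT.fderiv, canonicalForm_eq, canonicalForm_eq]
  have k1 := key v w.2
  have k2 := key w v.2
  rw [h5.eq] at k2
  simp only [ContinuousLinearMap.prod_apply, ContinuousLinearMap.comp_apply,
    ContinuousLinearMap.coe_snd']
  linarith

/-- The cotangent lift of a diffeomorphism-germ is an odd fibred symplectomorphism-germ. -/
theorem InverseGerms.isOddFibredSymplectoGerm {Λ N : (Fin m → ℝ) → (Fin m → ℝ)}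
    (h : InverseGerms r Λ N) (hr : r = ∞ ∨ r = ω) :
    IsOddFibredSymplectoGerm r (cotangentLift Λ N) := by
  have hs := h.smooth_cotangentLift hr
  refine ⟨⟨cotangentLift_zero h.apply_zero, isSmoothGerm_iff.2 hs, cotangentLift N Λ,
    cotangentLift_zero h.inv_zero, isSmoothGerm_iff.2 (h.symm.smooth_cotangentLift hr),
    h.cotangentLift_left hr, h.symm.cotangentLift_left hr⟩, ⟨Set.univ, univ_mem, ?_⟩, ?_, ?_⟩
  · intro x _ y _ hxy
    exact congrArg Λ hxy
  · refine symplectic_of_preserves_tautological hr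
      (hs.continuousLinearMap_comp (ContinuousLinearMap.fst ℝ _ _)) h.smooth ?_
    filter_upwards [tendsto_snd_zero.eventually (h.fderiv_left hr)] with x h1 u
    have h2 := cotangentLift_dotProduct Λ N x (fderiv ℝ Λ x.2 u)
    rw [h1] at h2
    exact h2
  · refine Eventually.of_forall fun x => Prod.ext (eq_of_dotProduct_eq fun v => ?_) rfl
    have h1 : (fibreInvolution (cotangentLift Λ N x)).1 = -(cotangentLift Λ N x).1 := rfl
    rw [h1, neg_dotProduct, cotangentLift_dotProduct, cotangentLift_dotProduct]
    simp [fibreInvolution]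

/-- An odd fibred symplectomorphism-germ covers a diffeomorphism-germ of the base and preserves
the tautological one-form. -/
theorem IsOddFibredSymplectoGerm.exists_base {T : PhaseSpace m → PhaseSpace m}
    (hT : IsOddFibredSymplectoGerm r T) (hr : r = ∞ ∨ r = ω) :
    ∃ Λ N : (Fin m → ℝ) → (Fin m → ℝ), InverseGerms r Λ N ∧
      (∀ᶠ x in 𝓝 (0 : PhaseSpace m), (T x).2 = Λ x.2) ∧
      ∀ᶠ x in 𝓝 (0 : PhaseSpace m), ∀ u,
        dotProduct (T x).1 (fderiv ℝ Λ x.2 u) = dotProduct x.1 u := by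
  obtain ⟨hT0, hTs, T', hT'0, hT's, hl, hri⟩ := hT.diffeo
  rw [isSmoothGerm_iff] at hTs hT's
  obtain ⟨U, hU, hfib⟩ := hT.fibred
  let Λ : (Fin m → ℝ) → (Fin m → ℝ) := fun l => (T (0, l)).2
  have hΛ : SmoothNear r Λ 0 :=
    (hTs.comp (SmoothNear.of_contDiff (by fun_prop : ContDiff ℝ r
      fun l : Fin m → ℝ => ((0, l) : PhaseSpace m))) rfl).continuousLinearMap_comp
      (ContinuousLinearMap.snd ℝ _ _)
  have hΛ0 : Λ 0 = 0 := congrArg Prod.snd hT0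
  have hproj : Tendsto (fun x : PhaseSpace m => ((0, x.2) : PhaseSpace m)) (𝓝 0) (𝓝 0) :=
    (by fun_prop : Continuous fun x : PhaseSpace m => ((0, x.2) : PhaseSpace m)).tendsto' _ _ rfl
  have hTΛ : ∀ᶠ x in 𝓝 (0 : PhaseSpace m), (T x).2 = Λ x.2 := by
    filter_upwards [hU, hproj hU] with x h1 h2 using hfib x h1 _ h2 rfl
  have hder : ∀ᶠ x in 𝓝 (0 : PhaseSpace m), ∀ v, (fderiv ℝ T x v).2 = fderiv ℝ Λ x.2 v.2 := by
    filter_upwards [hTΛ.eventually_nhds, hTs.eventually_differentiableAt hr,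
      tendsto_snd_zero.eventually (hΛ.eventually_differentiableAt hr)] with x h1 h2 h3 v
    have h4 : HasFDerivAt (fun x => (T x).2) _ x := h2.hasFDerivAt.snd
    have h5 : HasFDerivAt (fun x : PhaseSpace m => Λ x.2) _ x :=
      HasFDerivAt.comp (g := Λ) x h3.hasFDerivAt hasFDerivAt_snd
    exact DFunLike.congr_fun (h4.unique (h5.congr_of_eventuallyEq h1)) v
  obtain ⟨N, hN⟩ := hΛ.exists_inverseGerms hr hΛ0 (fun y => by
    have h1 := (hT's.fderiv_fderiv_of_inverse hr hT'0 hTs hri).self_of_nhds (0, y)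
    rw [hT'0] at h1
    refine ⟨(fderiv ℝ T' 0 (0, y)).2, ?_⟩
    have h2 := hder.self_of_nhds (fderiv ℝ T' 0 (0, y))
    rw [h1] at h2
    exact h2.symm)
  refine ⟨Λ, N, hN, hTΛ, ?_⟩
  -- The zero section is the fixed set of ζ, so an odd map preserves it.
  have hzero : ∀ᶠ x in 𝓝 (0 : PhaseSpace m), x.1 = 0 → (T x).1 = 0 := by
    filter_upwards [hT.odd] with x hx hx1
    have h1 : fibreInvolution x = x := Prod.ext (by simp [fibreInvolution, hx1]) rfl
    rw [h1] at hx
    exact self_eq_neg.1 (congrArg Prod.fst hx)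
  obtain ⟨ρ, hρ, hball⟩ := Metric.eventually_nhds_iff_ball.1
    ((hzero.and hder).and (hT.symplectic.and (hTs.eventually_differentiableAt hr)))
  filter_upwards [Metric.ball_mem_nhds (0 : PhaseSpace m) hρ] with x hx u
  have hx' := hx
  rw [mem_ball_zero_iff, Prod.norm_def, max_lt_iff] at hx'
  have hmem : ∀ κ ∈ Metric.ball (0 : Fin m → ℝ) ρ, (κ, x.2) ∈ Metric.ball (0 : PhaseSpace m) ρ := by
    intro κ hκ
    rw [mem_ball_zero_iff] at hκ ⊢
    exact max_lt hκ hx'.2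
  -- For fixed λ and u, symplecticity on the pair (k, 0), (0, u) shows that the difference of the
  -- two sides of the tautological identity is constant in κ. It vanishes on the zero section.
  have hd : ∀ κ ∈ Metric.ball (0 : Fin m → ℝ) ρ, HasFDerivWithinAt
      (fun κ => (dotL m).flip (fderiv ℝ Λ x.2 u) (T (κ, x.2)).1 - (dotL m).flip u κ)
      (0 : (Fin m → ℝ) →L[ℝ] ℝ) (Metric.ball 0 ρ) κ := by
    intro κ hκ
    obtain ⟨⟨-, h2⟩, h3, h4⟩ := hball _ (hmem κ hκ)
    have h5 : HasFDerivAt (fun κ => T (κ, x.2))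
        ((fderiv ℝ T (κ, x.2)).comp (ContinuousLinearMap.inl ℝ _ _)) κ :=
      HasFDerivAt.comp (g := T) κ h4.hasFDerivAt (hasFDerivAt_prodMk_left κ x.2)
    have h6 := (((dotL m).flip (fderiv ℝ Λ x.2 u)).hasFDerivAt.comp κ h5.fst).sub
      ((dotL m).flip u).hasFDerivAt (x := κ)
    refine HasFDerivAt.hasFDerivWithinAt ?_
    convert! h6 using 1
    refine ContinuousLinearMap.ext fun k => ?_
    have h7 := h3 (k, 0) (0, u)
    rw [canonicalForm_eq, canonicalForm_eq, h2, h2] at h7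
    simp only [map_zero, dotProduct_zero, sub_zero] at h7
    simp [h7]
  have h1 := (convex_ball (0 : Fin m → ℝ) ρ).norm_image_sub_le_of_norm_hasFDerivWithin_le (C := 0)
    hd (by simp) (Metric.mem_ball_self hρ) (mem_ball_zero_iff.2 hx'.1)
  have h2 : (T (0, x.2)).1 = 0 := (hball _ (hmem 0 (Metric.mem_ball_self hρ))).1.1 rfl
  have h3 : dotProduct (T (x.1, x.2)).1 (fderiv ℝ Λ x.2 u) - dotProduct x.1 u = 0 := by
    simpa [h2] using h1
  exact sub_eq_zero.1 h3

end CotangentLift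

/-! ### The two directions of the equivalence. -/

section Equivalence

variable {n n' m : ℕ} {r : WithTop ℕ∞}

/-- Critical points and momenta of `F` in terms of those of `G`, when `F` is locally the pullback
of `G` by a fibred submersion `(Φ, Λ)`. -/
theorem grad_of_pullback {F : BigSpace n m → ℝ} {G : BigSpace n' m → ℝ}
    {Φ : BigSpace n m → (Fin n' → ℝ)} {Λ : (Fin m → ℝ) → (Fin m → ℝ)} {p : BigSpace n m}
    (hΦ : DifferentiableAt ℝ Φ p) (hΛ : DifferentiableAt ℝ Λ p.2)
    (hG : DifferentiableAt ℝ G (Φ p, Λ p.2))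
    (hFG : F =ᶠ[𝓝 p] fun q => G (Φ q, Λ q.2))
    (hsurj : ∀ b', ∃ b, fderiv ℝ Φ p (b, 0) = b') :
    (gradVar F p = 0 ↔ gradVar G (Φ p, Λ p.2) = 0) ∧
      (gradVar F p = 0 → ∀ u, dotProduct (gradPar G (Φ p, Λ p.2)) (fderiv ℝ Λ p.2 u) =
        dotProduct (gradPar F p) u) := by
  have hΨ : HasFDerivAt (fun q : BigSpace n m => ((Φ q, Λ q.2) : BigSpace n' m))
      ((fderiv ℝ Φ p).prod ((fderiv ℝ Λ p.2).comp (ContinuousLinearMap.snd ℝ _ _))) p :=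
    hΦ.hasFDerivAt.prodMk (HasFDerivAt.comp (g := Λ) p hΛ.hasFDerivAt hasFDerivAt_snd)
  have hF := ((HasFDerivAt.comp (g := G) p hG.hasFDerivAt hΨ).congr_of_eventuallyEq hFG).fderiv
  have key : ∀ w : BigSpace n m, fderiv ℝ F p w =
      fderiv ℝ G (Φ p, Λ p.2) (fderiv ℝ Φ p w, fderiv ℝ Λ p.2 w.2) :=
    fun w => DFunLike.congr_fun hF w
  have hiff : gradVar F p = 0 ↔ gradVar G (Φ p, Λ p.2) = 0 := by
    rw [gradVar_eq, gradVar_eq, varPart_eq_zero_iff, varPart_eq_zero_iff]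
    constructor
    · intro h b'
      obtain ⟨b, hb⟩ := hsurj b'
      have h1 := key (b, 0)
      rw [h, hb, map_zero] at h1
      exact h1.symm
    · intro h b
      rw [key, map_zero]
      exact h _
  refine ⟨hiff, fun h u => ?_⟩
  have h1 := key (0, u)
  rw [fderiv_apply_eq F, fderiv_apply_eq G, h, hiff.1 h] at h1
  simpa using h1.symm

theorem SmoothNear.prodMap_snd {Φ : BigSpace n m → (Fin n' → ℝ)}
    {Λ : (Fin m → ℝ) → (Fin m → ℝ)} (hΦ : SmoothNear r Φ 0) (hΛ : SmoothNear r Λ 0) :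
    SmoothNear r (fun p : BigSpace n m => ((Φ p, Λ p.2) : BigSpace n' m)) 0 :=
  hΦ.prodMk hΛ.comp_snd

/-- The cotangent lift of the base map of a fibred `R^odd`-equivalence of generating families is
an equivalence of the generated Lagrangian germs. -/
theorem FibredRoddEquivalent.symmetricallyLagrangianEquivalent (hr : r = ∞ ∨ r = ω)
    {L₁ L₂ : Set (PhaseSpace m)} {F₁ : BigSpace n m → ℝ} (hF₁ : IsOddGeneratingFamily r F₁ L₁)
    {F₂ : BigSpace n' m → ℝ} (hF₂ : IsOddGeneratingFamily r F₂ L₂)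
    (h : FibredRoddEquivalent r F₁ F₂) : SymmetricallyLagrangianEquivalent r L₁ L₂ := by
  obtain ⟨Φ, Λ, ⟨hΨ0, hΨs, g, hg0, hgs, hl, hri⟩, -, -, hF⟩ := h
  rw [isSmoothGerm_iff] at hΨs hgs
  set Ψ : BigSpace n m → BigSpace n' m := fun p => (Φ p, Λ p.2) with hΨdef
  have hΦ : SmoothNear r Φ 0 := hΨs.continuousLinearMap_comp (ContinuousLinearMap.fst ℝ _ _)
  have hΛ : SmoothNear r Λ 0 :=
    (hΨs.comp (SmoothNear.of_contDiff (by fun_prop : ContDiff ℝ r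
      fun l : Fin m → ℝ => ((0, l) : BigSpace n m))) rfl).continuousLinearMap_comp
      (ContinuousLinearMap.snd ℝ _ _)
  have hΛ0 : Λ 0 = 0 := congrArg Prod.snd hΨ0
  have hΨt := hΨs.tendsto hΨ0
  have hgt := hgs.tendsto hg0
  have hder : ∀ᶠ p in 𝓝 (0 : BigSpace n m), ∀ w,
      fderiv ℝ Ψ p w = (fderiv ℝ Φ p w, fderiv ℝ Λ p.2 w.2) := by
    filter_upwards [hΦ.eventually_differentiableAt hr,
      tendsto_snd_zero.eventually (hΛ.eventually_differentiableAt hr)] with p h1 h2 w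
    have h3 : HasFDerivAt Ψ
        ((fderiv ℝ Φ p).prod ((fderiv ℝ Λ p.2).comp (ContinuousLinearMap.snd ℝ _ _))) p :=
      h1.hasFDerivAt.prodMk (HasFDerivAt.comp (g := Λ) p h2.hasFDerivAt hasFDerivAt_snd)
    rw [h3.fderiv]
    rfl
  have hsurjΨ : ∀ᶠ p in 𝓝 (0 : BigSpace n m), ∀ y, ∃ w, fderiv ℝ Ψ p w = y := by
    filter_upwards [hl, hΨt.eventually (hgs.fderiv_fderiv_of_inverse hr hg0 hΨs hri)]
      with p h1 h2 y
    have h3 := h2 y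
    rw [h1] at h3
    exact ⟨_, h3⟩
  obtain ⟨N, hN⟩ := hΛ.exists_inverseGerms hr hΛ0 (fun y => by
    obtain ⟨w, hw⟩ := hsurjΨ.self_of_nhds (0, y)
    rw [hder.self_of_nhds] at hw
    exact ⟨w.2, congrArg Prod.snd hw⟩)
  have hgrad : ∀ᶠ p in 𝓝 (0 : BigSpace n m),
      (gradVar F₁ p = 0 ↔ gradVar F₂ (Ψ p) = 0) ∧
      (gradVar F₁ p = 0 → ∀ u, dotProduct (gradPar F₂ (Ψ p)) (fderiv ℝ Λ p.2 u) =
        dotProduct (gradPar F₁ p) u) := by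
    filter_upwards [hΦ.eventually_differentiableAt hr,
      tendsto_snd_zero.eventually (hΛ.eventually_differentiableAt hr),
      hΨt.eventually ((isSmoothGerm_iff.1 hF₂.smooth).eventually_differentiableAt hr),
      hF.eventually_nhds, hsurjΨ, hder, tendsto_snd_zero.eventually (hN.fderiv_left hr)]
      with p h1 h2 h3 h4 h5 h6 h7
    -- A preimage of (b', 0) under dΨ is vertical, since dΛ is injective; so dΦ is onto already on
    -- vertical vectors.
    refine grad_of_pullback h1 h2 h3 h4 fun b' => ?_
    obtain ⟨w, hw⟩ := h5 (b', 0)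
    rw [h6] at hw
    have h8 : w.2 = 0 := by
      have h9 : fderiv ℝ Λ p.2 w.2 = 0 := congrArg Prod.snd hw
      rw [← h7 w.2, h9, map_zero]
    refine ⟨w.1, ?_⟩
    have h10 : ((w.1, 0) : BigSpace n m) = w := Prod.ext rfl h8.symm
    rw [h10]
    exact congrArg Prod.fst hw
  obtain ⟨U₁, hU₁, hgen₁⟩ := hF₁.generates
  obtain ⟨U₂, hU₂, hgen₂⟩ := hF₂.generates
  let W : Set (BigSpace n m) := {p | p ∈ U₁ ∧ Ψ p ∈ U₂ ∧ N (Λ p.2) = p.2 ∧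
    (gradVar F₁ p = 0 ↔ gradVar F₂ (Ψ p) = 0) ∧
      (gradVar F₁ p = 0 → ∀ u, dotProduct (gradPar F₂ (Ψ p)) (fderiv ℝ Λ p.2 u) =
        dotProduct (gradPar F₁ p) u)}
  have hW : W ∈ 𝓝 0 := by
    filter_upwards [hU₁, hΨt hU₂, tendsto_snd_zero.eventually hN.left, hgrad] with p h1 h2 h3 h4
      using ⟨h1, h2, h3, h4⟩
  -- For the converse inclusion the critical point of F₂ must lie where the inverse g of Ψ is
  -- defined and lands in W. The generating condition permits restricting F₂ to such a small
  -- neighbourhood.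
  let W' : Set (BigSpace n' m) := {q | q ∈ U₂ ∧ g q ∈ W ∧ Ψ (g q) = q}
  have hW' : W' ∈ 𝓝 0 := by
    filter_upwards [hU₂, hgt hW, hri] with q h1 h2 h3 using ⟨h1, h2, h3⟩
  have hT := hN.isOddFibredSymplectoGerm hr
  have hTt := (hN.smooth_cotangentLift hr).tendsto (cotangentLift_zero hΛ0)
  refine ⟨cotangentLift Λ N, hT, ?_⟩
  filter_upwards [hgen₁ W hW fun p hp => hp.1, hTt.eventually (hgen₂ U₂ hU₂ subset_rfl),
    hTt.eventually (hgen₂ W' hW' fun q hq => hq.1), tendsto_snd_zero.eventually hN.left,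
    tendsto_snd_zero.eventually (hN.fderiv_left hr),
    tendsto_snd_zero.eventually (hN.fderiv_right hr)] with x h1 h2 h3 h4 h5 h6
  constructor
  · intro hx
    obtain ⟨β, hβ, hc, hκ⟩ := h1.1 hx
    obtain ⟨-, hβ2, -, h7, h8⟩ := hβ
    refine h2.2 ⟨Φ (β, x.2), hβ2, h7.1 hc, eq_of_dotProduct_eq fun v => ?_⟩
    have h9 := h8 hc (fderiv ℝ N (Λ x.2) v)
    rw [h6 v, ← hκ] at h9
    rw [cotangentLift_dotProduct]
    exact h9.symm
  · intro hx
    obtain ⟨β', ⟨-, hgW, hΨg⟩, hc, hκ⟩ := h3.1 hx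
    set p := g (β', (cotangentLift Λ N x).2) with hp
    obtain ⟨-, -, h7, h8, h9⟩ := id hgW
    have h10 : Λ p.2 = Λ x.2 := congrArg Prod.snd hΨg
    have h11 : p.2 = x.2 := by rw [← h7, h10, h4]
    rw [← hΨg] at hc hκ
    have h12 : ((p.1, x.2) : BigSpace n m) = p := Prod.ext rfl h11.symm
    refine h1.2 ⟨p.1, ?_, ?_, eq_of_dotProduct_eq fun u => ?_⟩
    · rw [h12]; exact hgW
    · rw [h12]; exact h8.2 hc
    · rw [h12, ← h9 (h8.2 hc) u, ← hκ, cotangentLift_dotProduct, h11, h5]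

/-- The pullback of an odd family by a diffeomorphism-germ of the base is an odd family. -/
theorem IsOddFamily.pullback {F : BigSpace n m → ℝ} (hF : IsOddFamily r F) (hr : r = ∞ ∨ r = ω)
    {Λ N : (Fin m → ℝ) → (Fin m → ℝ)} (h : InverseGerms r Λ N) :
    IsOddFamily r (fun p => F (p.1, Λ p.2)) ∧
      ∀ᶠ p in 𝓝 (0 : BigSpace n m),
        gradVar (fun p => F (p.1, Λ p.2)) p = gradVar F (p.1, Λ p.2) ∧
        ∀ u, dotProduct (gradPar (fun p => F (p.1, Λ p.2)) p) u =
          dotProduct (gradPar F (p.1, Λ p.2)) (fderiv ℝ Λ p.2 u) := by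
  have hΨ : SmoothNear r (fun p : BigSpace n m => ((p.1, Λ p.2) : BigSpace n m)) 0 :=
    (SmoothNear.of_contDiff contDiff_fst).prodMap_snd h.smooth
  have hΨ0 : (((0 : BigSpace n m).1, Λ (0 : BigSpace n m).2) : BigSpace n m) = 0 := by
    simp [h.apply_zero]
  have hder : ∀ᶠ p in 𝓝 (0 : BigSpace n m), HasFDerivAt
      (fun p : BigSpace n m => ((p.1, Λ p.2) : BigSpace n m))
      ((ContinuousLinearMap.fst ℝ _ _).prod
        ((fderiv ℝ Λ p.2).comp (ContinuousLinearMap.snd ℝ _ _))) p := by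
    filter_upwards [tendsto_snd_zero.eventually (h.smooth.eventually_differentiableAt hr)] with p hp
    exact hasFDerivAt_fst.prodMk (HasFDerivAt.comp (g := Λ) p hp.hasFDerivAt hasFDerivAt_snd)
  have hgrad : ∀ᶠ p in 𝓝 (0 : BigSpace n m),
      gradVar (fun p => F (p.1, Λ p.2)) p = gradVar F (p.1, Λ p.2) ∧
      ∀ u, dotProduct (gradPar (fun p => F (p.1, Λ p.2)) p) u =
        dotProduct (gradPar F (p.1, Λ p.2)) (fderiv ℝ Λ p.2 u) := by
    filter_upwards [hder, (hΨ.tendsto hΨ0).eventually (hF.smooth.eventually_differentiableAt hr)]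
      with p h1 h2
    have h3 : fderiv ℝ (fun p => F (p.1, Λ p.2)) p = _ :=
      (HasFDerivAt.comp (g := F) p h2.hasFDerivAt h1).fderiv
    constructor
    · refine eq_of_dotProduct_eq fun b => ?_
      rw [gradVar_eq, gradVar_eq, varPart_dotProduct, varPart_dotProduct, h3]
      simp
    · intro u
      rw [gradPar_eq, gradPar_eq, parPart_dotProduct, parPart_dotProduct, h3]
      simp
  refine ⟨⟨hF.smooth.comp hΨ hΨ0, ?_, ?_, fun y => ?_⟩, hgrad⟩
  · filter_upwards [(hΨ.tendsto hΨ0).eventually hF.odd] with p hp using hp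
  · rw [hgrad.self_of_nhds.1, hΨ0, hF.critical]
  · have h1 : gradVar (fun p => F (p.1, Λ p.2)) =ᶠ[𝓝 0] fun p => gradVar F (p.1, Λ p.2) :=
      hgrad.mono fun p hp => hp.1
    have h2 : HasFDerivAt (gradVar F) (fderiv ℝ (gradVar F) 0)
        (((0 : BigSpace n m).1, Λ (0 : BigSpace n m).2) : BigSpace n m) := by
      rw [hΨ0]
      exact ((hF.smooth.gradVar hr).differentiableAt hr).hasFDerivAt
    have h3 := ((HasFDerivAt.comp (g := gradVar F) (0 : BigSpace n m) h2
      hder.self_of_nhds).congr_of_eventuallyEq h1).fderiv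
    obtain ⟨⟨b, l⟩, hbl⟩ := hF.surjective y
    refine ⟨(b, fderiv ℝ N (Λ 0) l), ?_⟩
    have h4 : fderiv ℝ Λ 0 (fderiv ℝ N (Λ 0) l) = l := (h.fderiv_right hr).self_of_nhds l
    rw [h3, ← hbl]
    exact congrArg (fun l' => fderiv ℝ (gradVar F) 0 (b, l')) h4

/-- An odd change of `β` and a diffeomorphism-germ of the base form a fibred `R^odd`-equivalence. -/
theorem IsOddChange.fibredRoddEquivalent {F G : BigSpace n m → ℝ} (hr : r = ∞ ∨ r = ω)
    {Φ : BigSpace n m → (Fin n → ℝ)} (hΦ : IsOddChange r Φ) {Λ N : (Fin m → ℝ) → (Fin m → ℝ)}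
    (hΛ : InverseGerms r Λ N) (h : ∀ᶠ p in 𝓝 (0 : BigSpace n m), F p = G (Φ p, Λ p.2)) :
    FibredRoddEquivalent r F G := by
  obtain ⟨J, hJ, hJl, hJr⟩ := hΦ.exists_inverse hr
  have hinr : Tendsto (fun l : Fin m → ℝ => ((0, l) : BigSpace n m)) (𝓝 0) (𝓝 0) :=
    (Continuous.prodMk_right (0 : Fin n → ℝ)).tendsto' _ _ rfl
  have hinl : ∀ l : Fin m → ℝ,
      Tendsto (fun b : Fin n → ℝ => ((b, l) : BigSpace n m)) (𝓝 0) (𝓝 (0, l)) := fun l =>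
    (Continuous.prodMk_left l).tendsto' _ _ rfl
  have hslice : ∀ {Θ : BigSpace n m → (Fin n → ℝ)}, SmoothNear r Θ 0 →
      ∀ᶠ l in 𝓝 (0 : Fin m → ℝ), SmoothNear r (fun b => Θ (b, l)) 0 := by
    intro Θ hΘ
    filter_upwards [hinr.eventually hΘ.eventually_nhds] with l hl
    have hl' : SmoothNear r Θ (0, l) := hl
    exact hl'.comp (SmoothNear.of_contDiff (by fun_prop)) rfl
  refine ⟨Φ, Λ, ?_, hΦ.odd, ?_, h⟩
  · have hs := hΦ.smooth.prodMap_snd hΛ.smooth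
    have hs' : SmoothNear r
        (fun q : BigSpace n m => ((J (q.1, N q.2), N q.2) : BigSpace n m)) 0 := by
      have h1 : SmoothNear r (fun q : BigSpace n m => ((q.1, N q.2) : BigSpace n m)) 0 :=
        (SmoothNear.of_contDiff contDiff_fst).prodMap_snd hΛ.smooth_inv
      exact (hJ.smooth.comp h1 (by simp [hΛ.inv_zero])).prodMap_snd hΛ.smooth_inv
    have hNt : Tendsto (fun q : BigSpace n m => ((q.1, N q.2) : BigSpace n m)) (𝓝 0) (𝓝 0) :=
      ((SmoothNear.of_contDiff contDiff_fst :
      SmoothNear r (fun p : BigSpace n m => p.1) 0).prodMap_snd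
        hΛ.smooth_inv).tendsto (by simp [hΛ.inv_zero])
    have hN0 : (((0 : BigSpace n m).1, N (0 : BigSpace n m).2) : BigSpace n m) = 0 := by
      simp [hΛ.inv_zero]
    refine ⟨by simp [hΦ.apply_zero, hΛ.apply_zero], isSmoothGerm_iff.2 hs,
      fun q => (J (q.1, N q.2), N q.2), ?_, isSmoothGerm_iff.2 hs', ?_, ?_⟩
    · simp only [hN0, hJ.apply_zero]
      simp [hΛ.inv_zero]
    · filter_upwards [hJl, tendsto_snd_zero.eventually hΛ.left] with p h1 h2
      simp only [h2, h1]
    · filter_upwards [hNt.eventually hJr, tendsto_snd_zero.eventually hΛ.right] with q h1 h2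
      simp only [h1, h2]
  · filter_upwards [hΦ.eventually_apply_zero, hJ.eventually_apply_zero, hslice hΦ.smooth,
      hslice hJ.smooth, hinr.eventually hJl.eventually_nhds, hinr.eventually hJr.eventually_nhds]
      with l h1 h2 h3 h4 h5 h6
    exact ⟨h1, isSmoothGerm_iff.2 h3, fun b => J (b, l), h2, isSmoothGerm_iff.2 h4,
      (hinl l).eventually h5, (hinl l).eventually h6⟩

/-- Generating families of equivalent Lagrangian germs are fibred `R^odd`-equivalent. -/
theorem SymmetricallyLagrangianEquivalent.fibredRoddEquivalent (hr : r = ∞ ∨ r = ω)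
    {L₁ L₂ : Set (PhaseSpace m)} {F₁ : BigSpace n m → ℝ} (hF₁ : IsOddGeneratingFamily r F₁ L₁)
    {F₂ : BigSpace n' m → ℝ} (hF₂ : IsOddGeneratingFamily r F₂ L₂)
    (h : SymmetricallyLagrangianEquivalent r L₁ L₂) : FibredRoddEquivalent r F₁ F₂ := by
  obtain ⟨T, hT, hTL⟩ := h
  obtain ⟨Λ, N, hΛ, hTΛ, hTA⟩ := hT.exists_base hr
  obtain ⟨hT0, hTs, T', hT'0, hT's, hl, hri⟩ := hT.diffeo
  rw [isSmoothGerm_iff] at hTs hT's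
  have hO₁ := hF₁.isOddFamily hr
  have hO₂ := hF₂.isOddFamily hr
  obtain ⟨hG, hgrad⟩ := hO₂.pullback hr hΛ
  set G : BigSpace n' m → ℝ := fun p => F₂ (p.1, Λ p.2) with hGdef
  obtain ⟨U₁, hU₁, hgen₁⟩ := hF₁.generates
  obtain ⟨U₂, hU₂, hgen₂⟩ := hF₂.generates
  have hTt := hTs.tendsto hT0
  have hT't := hT's.tendsto hT'0
  have hΨt : Tendsto (fun p : BigSpace n' m => ((p.1, Λ p.2) : BigSpace n' m)) (𝓝 0) (𝓝 0) :=
    ((SmoothNear.of_contDiff contDiff_fst :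
      SmoothNear r (fun p : BigSpace n' m => p.1) 0).prodMap_snd
      hΛ.smooth).tendsto (by simp [hΛ.apply_zero])
  have hNt : Tendsto (fun p : BigSpace n' m => ((p.1, N p.2) : BigSpace n' m)) (𝓝 0) (𝓝 0) :=
    ((SmoothNear.of_contDiff contDiff_fst :
      SmoothNear r (fun p : BigSpace n' m => p.1) 0).prodMap_snd
      hΛ.smooth_inv).tendsto (by simp [hΛ.inv_zero])
  have hpoint₁ : Tendsto (fun p => ((gradPar F₁ p, p.2) : PhaseSpace m)) (𝓝 0) (𝓝 0) :=
    ((hO₁.smooth.gradPar hr).prodMk (SmoothNear.of_contDiff contDiff_snd)).tendsto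
      (by simp [hO₁.gradPar_zero hr])
  have hpoint₂ : Tendsto (fun p => ((gradPar F₂ p, p.2) : PhaseSpace m)) (𝓝 0) (𝓝 0) :=
    ((hO₂.smooth.gradPar hr).prodMk (SmoothNear.of_contDiff contDiff_snd)).tendsto
      (by simp [hO₂.gradPar_zero hr])
  -- A critical point of G gives one of F₂ over Λ λ, hence a point of L₂. Its preimage under T lies
  -- in L₁ over λ and comes from a critical point of F₁ in U; preservation of the tautological form
  -- matches the momenta.
  have hFG : CriticallyCovers F₁ G := by
    intro U hU
    have hpt := hpoint₂.comp hΨt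
    filter_upwards [hgrad, hΨt hU₂, hpt.eventually (hgen₂ U₂ hU₂ subset_rfl), hpt.eventually hri,
      (hT't.comp hpt).eventually hTL,
      (hT't.comp hpt).eventually (hgen₁ (U ∩ U₁) (inter_mem hU hU₁) Set.inter_subset_right),
      (hT't.comp hpt).eventually hTΛ, (hT't.comp hpt).eventually hTA,
      (tendsto_snd_zero.comp (hT't.comp hpt)).eventually hΛ.left,
      tendsto_snd_zero.eventually hΛ.left] with p h1 h2 h3 h4 h5 h6 h7 h8 h9 h10 hc
    simp only [Function.comp_apply] at h3 h4 h5 h6 h7 h8 h9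
    set y : PhaseSpace m := (gradPar F₂ (p.1, Λ p.2), Λ p.2) with hy
    have hyL : y ∈ L₂ := h3.2 ⟨p.1, h2, h1.1 ▸ hc, rfl⟩
    rw [h4] at h5 h7 h8
    have hx : (T' y).2 = p.2 := by
      rw [← h9, ← h7, hy, h10]
    obtain ⟨β, hβ, hβc, hβκ⟩ := h6.1 (h5.2 hyL)
    rw [hx] at hβ hβc hβκ h8
    refine ⟨β, hβ.1, hβc, eq_of_dotProduct_eq fun u => ?_⟩
    rw [← hβκ, h1.2, ← h8 u]
  have hGF : CriticallyCovers G F₁ := by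
    intro U hU
    filter_upwards [hU₁, hpoint₁.eventually (hgen₁ U₁ hU₁ subset_rfl), hpoint₁.eventually hTL,
      -- The neighbourhood U and the gradient formulas for G are transported by N to the base
      -- coordinates of F₂, so that the critical point obtained for F₂ yields one of G inside U.
      (hTt.comp hpoint₁).eventually (hgen₂ (U₂ ∩ {q | (q.1, N q.2) ∈ U ∧
        (gradVar G (q.1, N q.2) = gradVar F₂ (q.1, Λ (N q.2)) ∧
        ∀ u, dotProduct (gradPar G (q.1, N q.2)) u =
          dotProduct (gradPar F₂ (q.1, Λ (N q.2))) (fderiv ℝ Λ (N q.2) u))})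
        (inter_mem hU₂ ((hNt.eventually hU).and (hNt.eventually hgrad))) Set.inter_subset_left),
      hpoint₁.eventually hTΛ, hpoint₁.eventually hTA,
      tendsto_snd_zero.eventually hΛ.left] with p h1 h2 h3 h4 h5 h6 h7 hc
    simp only [Function.comp_apply] at h4
    have hxL : ((gradPar F₁ p, p.2) : PhaseSpace m) ∈ L₁ := h2.2 ⟨p.1, h1, hc, rfl⟩
    obtain ⟨β, ⟨-, hβU, hβ1, hβ2⟩, hβc, hβκ⟩ := h4.1 (h3.1 hxL)
    rw [h5] at hβU hβ1 hβ2 hβc hβκ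
    simp only [h7] at hβU hβ1 hβ2
    refine ⟨β, hβU, hβ1.trans hβc, eq_of_dotProduct_eq fun u => ?_⟩
    rw [hβ2, ← hβκ, h6]
  -- Covering in each direction embeds one space of variables β linearly into the other, so the
  -- numbers of variables agree.
  obtain rfl : n = n' :=
    le_antisymm (hG.card_le_of_covers hO₁ hr hGF) (hO₁.card_le_of_covers hG hr hFG)
  obtain ⟨Φ, hΦ, hFΦ⟩ := hO₁.exists_change hG hr hFG hGF
  exact hΦ.fibredRoddEquivalent hr hΛ hFΦ

end Equivalence

theorem mainTheorem1 (r : WithTop ℕ∞) (hr : r = ∞ ∨ r = ω) (m n₁ n₂ : ℕ)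
    (L₁ L₂ : Set (PhaseSpace m))
    (hL₁ : IsLagrangianGerm r L₁) (hS₁ : IsFibredSymmetricGerm L₁)
    (hL₂ : IsLagrangianGerm r L₂) (hS₂ : IsFibredSymmetricGerm L₂)
    (F₁ : BigSpace n₁ m → ℝ) (hF₁ : IsOddGeneratingFamily r F₁ L₁)
    (F₂ : BigSpace n₂ m → ℝ) (hF₂ : IsOddGeneratingFamily r F₂ L₂) :
    SymmetricallyLagrangianEquivalent r L₁ L₂ ↔ FibredRoddEquivalent r F₁ F₂ :=
  ⟨fun h => h.fibredRoddEquivalent hr hF₁ hF₂,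
    fun h => h.symmetricallyLagrangianEquivalent hr hF₁ hF₂⟩
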